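/- Consider a finite collection of subsystems with finite-dimensional Hilbert spaces $\mathcal H_a$, and $\mathcal H=\bigotimes_a\mathcal H_a$. A neighborhood structure $\mathcal N=\{\mathcal N_j\}$ is a hypergraph on the set of subsystems whose hyperedges (neighborhoods) are proper subsets and such that every subsystem lies in some neighborhood. A (coarse-grained) particle is a class of subsystems that are contained in exactly the same neighborhoods. $\mathcal N$ is tree-like if: (i) (matching overlap) whenever a set of neighborhoods has a nonempty common intersection, this is also the intersection of any two distinct neighborhoods in the set; and (ii) there is no cycle path, i.e. no sequence $v_0,\mathcal N_{k_1},v_1,\mathcal N_{k_2},\dots,\mathcal N_{k_m},v_m$ with $m\ge 2$, where $\mathcal N_{k_1},\dots,\mathcal N_{k_m}$ are pairwise distinct neighborhoods, $v_0,\dots,v_m$ are particles that are pairwise distinct except that $v_0=v_m$, and $v_{l-1},v_l\subseteq\mathcal N_{k_l}$ for all $l$. For a unit vector $|\psi\rangle\in\mathcal H$, let $\Pi_j$ be the orthogonal projector onto $\mathrm{supp}\big(\mathrm{Tr}_{\overline{\mathcal N}_j}(|\psi\rangle\langle\psi|)\otimes I_{\overline{\mathcal N}_j}\big)$. The state $|\psi\rangle$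 is robustly finite-time stabilizable (RFTS) with respect to $\mathcal N$ if there are finitely many completely positive trace-preserving maps $\mathcal E_1,\dots,\mathcal E_T$, each acting nontrivially on one neighborhood only, such that every $\mathcal E_t$ leaves $|\psi\rangle\langle\psi|$ invariant and, for every permutation $p$ of $\{1,\dots,T\}$ and every density operator $\sigma$, $(\mathcal E_{p(T)}\circ\dots\circ\mathcal E_{p(1)})(\sigma)=|\psi\rangle\langle\psi|$. **Theorem.** Let $\mathcal N$ be a tree-like neighborhood structure and $|\psi\rangle\in\mathcal H$ a unit vector. Then $|\psi\rangle$ is RFTS with respect to $\mathcal N$ if and only if the projectors $\Pi_j$ commute pairwise and $|\psi\rangle$ is, up to a phase, the unique ground state of its canonical parent Hamiltonian $H_{|\psi\rangle}=\sum_j(I-\Pi_j)$. -/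

import Mathlib

open scoped Matrix Kronecker ComplexOrder

/-- A neighborhood structure on the subsystems `ι`: a hypergraph whose hyperedges (neighborhoods)
are proper subsets of the set of subsystems, and such that every subsystem lies in some
neighborhood. -/
structure NeighborhoodStructure (ι : Type*) [Fintype ι] [DecidableEq ι] where
  /-- the set of neighborhoods -/
  sets : Finset (Finset ι)
  proper : ∀ S ∈ sets, S ⊂ Finset.univ
  cover : ∀ i : ι, ∃ S ∈ sets, i ∈ S

namespace NeighborhoodStructure

variable {ι : Type*} [Fintype ι] [DecidableEq ι]

/-- Two subsystems belong to the same coarse-grained particle when they are contained in exactly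
the same neighborhoods. -/
def SameParticle (𝒩 : NeighborhoodStructure ι) (i j : ι) : Prop :=
  ∀ S ∈ 𝒩.sets, i ∈ S ↔ j ∈ S

/-- The set of the subsystems that are common to all the members of `𝒮`. -/
def commonPart (𝒮 : Finset (Finset ι)) : Finset ι :=
  Finset.univ.filter fun i => ∀ S ∈ 𝒮, i ∈ S

/-- Matching overlap: whenever a set of neighborhoods has a (nonempty) common intersection, this
common intersection is also the intersection of any pair of distinct neighborhoods in the set. -/
def MatchingOverlap (𝒩 : NeighborhoodStructure ι) : Prop :=
  ∀ 𝒮 ⊆ 𝒩.sets, (commonPart 𝒮).Nonempty →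
    ∀ A ∈ 𝒮, ∀ B ∈ 𝒮, A ≠ B → A ∩ B = commonPart 𝒮

/-- A path `j 0, k 0, j 1, k 1, …, k (m - 1), j m`: pairwise distinct neighborhoods `k l`,
interspaced by particles `j l` (each given by one of its subsystems) which are pairwise distinct,
except that the first and the last one may coincide, where `j l` and `j (l + 1)` both lie in
`k l`. -/
structure IsPath (𝒩 : NeighborhoodStructure ι) (m : ℕ) (j : Fin (m + 1) → ι)
    (k : Fin m → Finset ι) : Prop where
  distinct_particles : ∀ l l' : Fin (m + 1), l < l' → 𝒩.SameParticle (j l) (j l') →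
    l = 0 ∧ l' = Fin.last m
  distinct_sets : Function.Injective k
  mem_sets : ∀ l, k l ∈ 𝒩.sets
  mem_left : ∀ l : Fin m, j l.castSucc ∈ k l
  mem_right : ∀ l : Fin m, j l.succ ∈ k l

/-- A cycle path: a path through at least two neighborhoods whose first and last particles
coincide. (Sequences `a, k 0, a` through one neighborhood exist in every hypergraph, and are not
cycles.) -/
def IsCyclePath (𝒩 : NeighborhoodStructure ι) (m : ℕ) (j : Fin (m + 1) → ι)
    (k : Fin m → Finset ι) : Prop :=
  2 ≤ m ∧ 𝒩.IsPath m j k ∧ 𝒩.SameParticle (j 0) (j (Fin.last m))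

/-- A neighborhood structure is tree-like if it has the matching overlap property and no
cycle paths. -/
def TreeLike (𝒩 : NeighborhoodStructure ι) : Prop :=
  𝒩.MatchingOverlap ∧ ∀ m j k, ¬ 𝒩.IsCyclePath m j k

end NeighborhoodStructure

noncomputable section

namespace QuasiLocal

variable {ι : Type*} [Fintype ι] [DecidableEq ι]
  {κ : ι → Type*} [∀ i, Fintype (κ i)] [∀ i, DecidableEq (κ i)]

/-- Labels of the product basis: subsystem `i` has the Hilbert space `ℂ^(κ i)`. -/
abbrev Config (κ : ι → Type*) : Type _ := ∀ i, κ i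

/-- Labels of the product basis of the subsystems in `S`. -/
abbrev LocalConfig (κ : ι → Type*) (S : Finset ι) : Type _ := ∀ i : {i // i ∈ S}, κ i

/-- The multipartite Hilbert space `⨂ i, ℂ^(κ i)`, in its product basis. -/
abbrev Space (κ : ι → Type*) [∀ i, Fintype (κ i)] : Type _ := EuclideanSpace ℂ (Config κ)

/-- Linear operators on the multipartite Hilbert space, as matrices in the product basis. -/
abbrev Op (κ : ι → Type*) : Type _ := Matrix (Config κ) (Config κ) ℂ

/-- The splitting of a product label into its part in `S` and its part outside of `S`. -/
def split (κ : ι → Type*) (S : Finset ι) :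
    Config κ ≃ LocalConfig κ S × (∀ i : {i // ¬ i ∈ S}, κ i) :=
  Equiv.piEquivPiSubtypeProd (fun i => i ∈ S) κ

/-- The operator `M ⊗ I`, with `M` acting on the subsystems in `S`. -/
def extend (S : Finset ι) (M : Matrix (LocalConfig κ S) (LocalConfig κ S) ℂ) : Op κ :=
  (M ⊗ₖ (1 : Matrix (∀ i : {i // ¬ i ∈ S}, κ i) (∀ i : {i // ¬ i ∈ S}, κ i) ℂ)).submatrix
    (split κ S) (split κ S)

/-- The partial trace over the subsystems outside of `S`. -/
def reduced (S : Finset ι) (ρ : Op κ) : Matrix (LocalConfig κ S) (LocalConfig κ S) ℂ :=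
  Matrix.of fun x y => ∑ z : (∀ i : {i // ¬ i ∈ S}, κ i),
    ρ ((split κ S).symm (x, z)) ((split κ S).symm (y, z))

/-- Density operators. -/
def IsDensity (ρ : Op κ) : Prop := ρ.PosSemidef ∧ ρ.trace = 1

/-- The operator `|ψ⟩⟨ψ|`. -/
def pureState (ψ : Space κ) : Op κ := Matrix.vecMulVec ψ.ofLp (star ψ.ofLp)

/-- The orthogonal projector onto the support (the range) of a self-adjoint operator. -/
def suppProj (A : Op κ) : Space κ →L[ℂ] Space κ :=
  (LinearMap.range
    (Matrix.toEuclideanCLM (n := Config κ) (𝕜 := ℂ) A).toLinearMap).starProjection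

/-- The orthogonal projector onto `supp (Tr_{outside S} |ψ⟩⟨ψ|) ⊗ H_{outside S}`. -/
def nbhdProj (ψ : Space κ) (S : Finset ι) : Space κ →L[ℂ] Space κ :=
  suppProj (extend S (reduced S (pureState ψ)))

/-- Completely positive trace-preserving maps acting on the subsystems in `S` only: they have an
operator sum representation `X ↦ ∑ₖ Mₖ X Mₖ†` with `∑ₖ Mₖ† Mₖ = I`, all of whose operators `Mₖ`
have the form `M ⊗ I`, with `M` acting on `S`. -/
def IsLocalCPTP (S : Finset ι) (E : Op κ →ₗ[ℂ] Op κ) : Prop :=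
  ∃ (r : ℕ) (M : Fin r → Matrix (LocalConfig κ S) (LocalConfig κ S) ℂ),
    (∑ k, (extend S (M k))ᴴ * extend S (M k) = 1) ∧
    ∀ X, E X = ∑ k, extend S (M k) * X * (extend S (M k))ᴴ

/-- Consecutive action of the maps `E 0, E 1, …, E (T - 1)`, in this order, on `X`. -/
def evolve {T : ℕ} (E : Fin T → (Op κ →ₗ[ℂ] Op κ)) (X : Op κ) : Op κ :=
  (List.ofFn E).foldl (fun Y F => F Y) X

/-- Robust finite-time stabilizability: there are finitely many CPTP neighborhood maps that all
leave `ρ` invariant and that, composed in any order, send every density operator to `ρ`. -/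
def IsRFTS (𝒩 : NeighborhoodStructure ι) (ρ : Op κ) : Prop :=
  ∃ (T : ℕ) (E : Fin T → (Op κ →ₗ[ℂ] Op κ)),
    (∀ t, ∃ S ∈ 𝒩.sets, IsLocalCPTP S (E t)) ∧
    (∀ t, E t ρ = ρ) ∧
    ∀ p : Equiv.Perm (Fin T), ∀ σ : Op κ, IsDensity σ → evolve (fun t => E (p t)) σ = ρ

/-- The canonical frustration-free parent Hamiltonian `∑ⱼ (I - Πⱼ)` of `ψ`. -/
def canonicalHamiltonian (𝒩 : NeighborhoodStructure ι) (ψ : Space κ) :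
    Space κ →L[ℂ] Space κ :=
  ∑ S ∈ 𝒩.sets, (1 - nbhdProj ψ S)

/-- `φ` is a ground state of `H`: a unit vector minimizing the energy `⟨φ|H|φ⟩`. -/
def IsGroundState (H : Space κ →L[ℂ] Space κ) (φ : Space κ) : Prop :=
  ‖φ‖ = 1 ∧ ∀ χ : Space κ, ‖χ‖ = 1 → (inner ℂ φ (H φ)).re ≤ (inner ℂ χ (H χ)).re

/-- `ψ` is the unique ground state of `H`, up to a phase. -/
def IsUniqueGroundState (H : Space κ →L[ℂ] Space κ) (ψ : Space κ) : Prop :=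
  IsGroundState H ψ ∧ ∀ φ, IsGroundState H φ → ∃ c : ℂ, φ = c • ψ

end QuasiLocal

end

/-! Write ρ = |ψ⟩⟨ψ|, and P(C) for the projector onto the common range of the Π_j with j in a family
C (`meet`). Everything rests on one locality principle, `mul_locSupp_eq_zero`: an operator acting on
S that kills a projection P also kills the local support projector of P on S. In particular, an
operator on a neighborhood that has ψ as an eigenvector acts as the same scalar on the whole range
of Π_j.

Necessity. The Kraus operators of a neighborhood map fixing ρ have ψ as an eigenvector, hence are
scalar on the range of Π_j. If the neighborhoods are covered by families A and B, run all the maps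
of A first: they fix P(A) Y ρ, and the remaining maps multiply it on the left by some L with P(B) L
= P(B). The outcome must be a multiple of ρ, which forces P(B) P(A) = ρ (`meet_mul_meet_of_isRFTS`).
Taking both families to be everything gives uniqueness of the ground state. For two overlapping
neighborhoods the absence of cycles provides a cut: two complementary families whose regions meet
only inside the overlap (`exists_cut`). Then ρ is a product of two commuting projections across the
cut, the local supports factorize accordingly, and Π_A and Π_B commute (`nbhdMat_eq_mul`,
`commute_nbhdMat_of_cut`).

Sufficiency. It is enough to find, for each J, a channel on J that maps into the range of Π_J and
preserves the ranges of the other Π_k: in any order, the output then lies in all the ranges, whose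
intersection is spanned by ψ. Let V be the *-algebra of operators on J commuting with the other Π_k,
with Hilbert–Schmidt orthonormal basis D_b. The sum Z = ∑ D_b† Π_J D_b is central in V. Matching
overlap makes the overlaps of J with its neighbors equal or disjoint, and then Z is a positive
scalar on the common range of the supports on these overlaps (`exists_mul_meet_eq_smul`). After a
first channel into that common range, the operators Π_J D_b, suitably scaled, are therefore trace
preserving (`hasKraus_nbhd`). -/

set_option linter.unusedSectionVars false

/-! ### Algebras of local operators and the partial trace. -/

namespace QuasiLocal

variable {ι : Type*} [Fintype ι] [DecidableEq ι]
  {κ : ι → Type*} [∀ i, Fintype (κ i)] [∀ i, DecidableEq (κ i)]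

/-- The matrix unit `|a⟩⟨b|` of the subsystem `i`. -/
def siteUnit (i : ι) (a b : κ i) : Op κ :=
  Matrix.of fun x y => if x i = a ∧ y = Function.update x i b then 1 else 0

lemma siteUnit_mul_apply (i : ι) (a b : κ i) (X : Op κ) (x y : Config κ) :
    (siteUnit i a b * X) x y = if x i = a then X (Function.update x i b) y else 0 := by
  rw [Matrix.mul_apply, Finset.sum_eq_single (Function.update x i b)]
  · simp [siteUnit]
  · intro z _ hz
    simp [siteUnit, hz]
  · simp

lemma eq_update_comm_iff {i : ι} {a b : κ i} {x y : Config κ} :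
    (x i = a ∧ y = Function.update x i b) ↔ (y i = b ∧ x = Function.update y i a) := by
  constructor <;> rintro ⟨rfl, rfl⟩ <;> simp

lemma mul_siteUnit_apply (i : ι) (a b : κ i) (X : Op κ) (x y : Config κ) :
    (X * siteUnit i a b) x y = if y i = b then X x (Function.update y i a) else 0 := by
  rw [Matrix.mul_apply, Finset.sum_eq_single (Function.update y i a)]
  · simp [siteUnit]
  · intro z _ hz
    simp [siteUnit, eq_update_comm_iff, hz]
  · simp

lemma star_siteUnit (i : ι) (a b : κ i) : star (siteUnit i a b : Op κ) = siteUnit i b a := by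
  ext x y
  simp only [Matrix.star_apply, siteUnit, Matrix.of_apply]
  simp only [eq_update_comm_iff (x := y)]
  split_ifs <;> simp

/-- The operators that act on the subsystems in `S` only. -/
def loc (κ : ι → Type*) [∀ i, Fintype (κ i)] [∀ i, DecidableEq (κ i)] (S : Finset ι) :
    StarSubalgebra ℂ (Op κ) :=
  StarSubalgebra.centralizer ℂ {X | ∃ i ∉ S, ∃ a b, X = siteUnit i a b}

lemma mem_loc {S : Finset ι} {X : Op κ} :
    X ∈ loc κ S ↔ ∀ i ∉ S, ∀ a b, Commute (siteUnit i a b) X := by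
  rw [loc, StarSubalgebra.mem_centralizer_iff]
  constructor
  · intro h i hi a b
    exact (h _ ⟨i, hi, a, b, rfl⟩).1
  · rintro h _ ⟨i, hi, a, b, rfl⟩
    exact ⟨h i hi a b, by rw [star_siteUnit]; exact h i hi b a⟩

lemma loc_mono {S T : Finset ι} (h : S ⊆ T) : loc κ S ≤ loc κ T := fun _ hX =>
  mem_loc.2 fun i hi a b => mem_loc.1 hX i (fun h' => hi (h h')) a b

lemma mem_loc_inter {S T : Finset ι} {X : Op κ} (hS : X ∈ loc κ S) (hT : X ∈ loc κ T) :
    X ∈ loc κ (S ∩ T) :=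
  mem_loc.2 fun i hi a b => by
    by_cases h : i ∈ S
    · exact mem_loc.1 hT i (fun h' => hi (Finset.mem_inter.2 ⟨h, h'⟩)) a b
    · exact mem_loc.1 hS i h a b

lemma siteUnit_mem_loc {S : Finset ι} {i : ι} (hi : i ∈ S) (a b : κ i) :
    siteUnit i a b ∈ loc κ S := by
  refine mem_loc.2 fun j hj c d => ?_
  have hij : i ≠ j := fun h => hj (h ▸ hi)
  ext x y
  rw [siteUnit_mul_apply, mul_siteUnit_apply]
  simp only [siteUnit, Matrix.of_apply, Function.update_of_ne hij]
  by_cases hx : x i = a <;> by_cases hc : x j = c <;> by_cases hy : y j = d <;> simp only [hx, hc, hy, true_and, false_and, if_true, if_false]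
  · congr 1
    rw [eq_iff_iff]
    constructor
    · rintro rfl
      rw [Function.update_comm hij, Function.update_idem, ← hc, Function.update_eq_self]
    · intro h
      rw [Function.update_comm hij.symm, ← h, Function.update_idem, ← hy, Function.update_eq_self]
  · rw [if_neg]
    rintro rfl
    simp [Function.update_of_ne hij.symm] at hy
  · rw [if_neg]
    intro h
    apply hc
    have := congrFun h j
    simpa [Function.update_of_ne hij.symm] using this.symm

lemma apply_eq_zero_of_mem_loc {S : Finset ι} {X : Op κ} (hX : X ∈ loc κ S) {i : ι} (hi : i ∉ S)
    {x y : Config κ} (hxy : x i ≠ y i) : X x y = 0 := by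
  have h := congrFun (congrFun (mem_loc.1 hX i hi (x i) (x i)) x) y
  rw [siteUnit_mul_apply, mul_siteUnit_apply] at h
  simpa [hxy.symm] using h

lemma apply_update_of_mem_loc {S : Finset ι} {X : Op κ} (hX : X ∈ loc κ S) {i : ι} (hi : i ∉ S)
    {x y : Config κ} (hxy : x i = y i) (c : κ i) :
    X (Function.update x i c) (Function.update y i c) = X x y := by
  have h := congrFun (congrFun (mem_loc.1 hX i hi (x i) c) x) (Function.update y i c)
  rw [siteUnit_mul_apply, mul_siteUnit_apply] at h
  simpa [hxy] using h

lemma apply_piecewise_of_mem_loc {S : Finset ι} {X : Op κ} (hX : X ∈ loc κ S) (z : Config κ)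
    {F : Finset ι} (hF : ∀ i ∈ F, i ∉ S) {x y : Config κ} (hxy : ∀ i ∈ F, x i = y i) :
    X (F.piecewise z x) (F.piecewise z y) = X x y := by
  induction F using Finset.induction_on with
  | empty => simp
  | insert i F hi ih =>
    rw [Finset.piecewise_insert, Finset.piecewise_insert, apply_update_of_mem_loc hX (hF i (by simp)),
      ih (fun j hj => hF j (by simp [hj])) (fun j hj => hxy j (by simp [hj]))]
    simp [hi, hxy i (by simp)]

lemma extend_apply (S : Finset ι) (M : Matrix (LocalConfig κ S) (LocalConfig κ S) ℂ)
    (x y : Config κ) :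
    extend S M x y = if ∀ i ∉ S, x i = y i then M (fun i => x i) (fun i => y i) else 0 := by
  simp only [extend, Matrix.submatrix_apply, Matrix.kroneckerMap_apply, split,
    Equiv.piEquivPiSubtypeProd_apply, Matrix.one_apply]
  by_cases h : ∀ i ∉ S, x i = y i
  · rw [if_pos h, if_pos (by ext i; exact h i i.2), mul_one]
  · rw [if_neg h, if_neg (fun h' => h fun i hi => congrFun h' ⟨i, hi⟩), mul_zero]

/-- The operators that act on `S` only commute with those that act off `S` only. -/
lemma commute_extend {S : Finset ι} (M : Matrix (LocalConfig κ S) (LocalConfig κ S) ℂ)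
    {T : Finset ι} (hST : ∀ i ∈ S, i ∉ T) {Y : Op κ} (hY : Y ∈ loc κ T) :
    Commute (extend S M) Y := by
  ext x y
  rw [Matrix.mul_apply, Matrix.mul_apply, Finset.sum_eq_single (S.piecewise y x),
    Finset.sum_eq_single (S.piecewise x y)]
  · rw [extend_apply, extend_apply, if_pos (by intro i hi; simp [hi]),
      if_pos (by intro i hi; simp [hi])]
    have h := apply_piecewise_of_mem_loc hY y hST (x := x) (y := S.piecewise x y)
      (fun i hi => by simp [hi])
    have h1 : S.piecewise y (S.piecewise x y) = y := by
      ext i; by_cases hi : i ∈ S <;> simp [hi]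
    rw [h1] at h
    rw [h, mul_comm]
    congr 2 <;> ext i <;> simp
  · intro z _ hz
    by_cases h : ∀ i ∉ S, z i = y i
    · have : ∃ i ∈ S, x i ≠ z i := by
        by_contra! hc
        exact hz (by ext i; by_cases hi : i ∈ S <;> simp [hi, hc, h])
      obtain ⟨i, hi, hne⟩ := this
      rw [apply_eq_zero_of_mem_loc hY (hST i hi) hne, zero_mul]
    · rw [extend_apply, if_neg h, mul_zero]
  · simp
  · intro z _ hz
    by_cases h : ∀ i ∉ S, x i = z i
    · have : ∃ i ∈ S, z i ≠ y i := by
        by_contra! hc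
        exact hz (by ext i; by_cases hi : i ∈ S <;> simp [hi, hc, h])
      obtain ⟨i, hi, hne⟩ := this
      rw [apply_eq_zero_of_mem_loc hY (hST i hi) hne, mul_zero]
    · rw [extend_apply, if_neg h, zero_mul]
  · simp

lemma extend_mem_loc (S : Finset ι) (M : Matrix (LocalConfig κ S) (LocalConfig κ S) ℂ) :
    extend S M ∈ loc κ S :=
  mem_loc.2 fun i hi a b => (commute_extend M (T := {i})
    (fun _ hj hji => hi (Finset.mem_singleton.1 hji ▸ hj))
    (siteUnit_mem_loc (Finset.mem_singleton_self i) a b)).symm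

/-- Commuting with the matrix units off `S` makes the entries vanish when the outer labels differ,
and independent of the outer label when they agree; so `M` is read off with the outer label frozen
at an arbitrary `z`. This links the commutant definition, convenient for inclusions and
intersections, to the tensor form. -/
lemma exists_eq_extend {S : Finset ι} {X : Op κ} (hX : X ∈ loc κ S) :
    ∃ M : Matrix (LocalConfig κ S) (LocalConfig κ S) ℂ, X = extend S M := by
  rcases isEmpty_or_nonempty (Config κ) with h | ⟨⟨z⟩⟩
  · exact ⟨0, by ext x; exact h.elim x⟩
  · let f : LocalConfig κ S → Config κ := fun a i => if h : i ∈ S then a ⟨i, h⟩ else z i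
    refine ⟨Matrix.of fun a b => X (f a) (f b), ?_⟩
    ext x y
    rw [extend_apply]
    split_ifs with h
    · rw [← apply_piecewise_of_mem_loc hX z (F := Sᶜ) (by simp) (x := x) (y := y) (by simpa using h)]
      simp only [Matrix.of_apply]
      congr 1 <;> ext i <;> by_cases hi : i ∈ S <;> simp [f, hi]
    · push Not at h
      obtain ⟨i, hi, hne⟩ := h
      exact apply_eq_zero_of_mem_loc hX hi hne

lemma commute_of_disjoint {S T : Finset ι} (hST : Disjoint S T) {X Y : Op κ} (hX : X ∈ loc κ S)
    (hY : Y ∈ loc κ T) : Commute X Y := by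
  obtain ⟨M, rfl⟩ := exists_eq_extend hX
  exact commute_extend M (fun i hi => Finset.disjoint_left.1 hST hi) hY

lemma exists_eq_smul_one_of_mem_loc_empty {X : Op κ} (hX : X ∈ loc κ ∅) :
    ∃ c : ℂ, X = c • (1 : Op κ) := by
  obtain ⟨M, rfl⟩ := exists_eq_extend hX
  refine ⟨M default default, ?_⟩
  ext x y
  rw [extend_apply]
  have : (∀ i ∉ (∅ : Finset ι), x i = y i) ↔ x = y := by simp [funext_iff]
  simp only [this, Matrix.smul_apply, Matrix.one_apply, smul_eq_mul, mul_ite, mul_one, mul_zero]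
  congr 1
  congr 1 <;> exact Subsingleton.elim _ _

/-- Labels of the product basis of the subsystems outside of `S`. -/
abbrev OuterConfig (κ : ι → Type*) (S : Finset ι) : Type _ := ∀ i : {i // ¬ i ∈ S}, κ i

/-- The matrix units `I ⊗ |a⟩⟨b|` of the subsystems outside of `S`. -/
def outerUnit (S : Finset ι) (a b : OuterConfig κ S) : Op κ :=
  ((1 : Matrix (LocalConfig κ S) (LocalConfig κ S) ℂ) ⊗ₖ Matrix.single a b 1).submatrix
    (split κ S) (split κ S)

lemma outerUnit_mul_same (S : Finset ι) (a b d : OuterConfig κ S) :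
    outerUnit S a b * outerUnit S b d = outerUnit S a d := by
  rw [outerUnit, outerUnit, Matrix.submatrix_mul_equiv, ← Matrix.mul_kronecker_mul]
  simp [outerUnit]

lemma outerUnit_mul_of_ne (S : Finset ι) (a b c d : OuterConfig κ S) (h : b ≠ c) :
    outerUnit S a b * outerUnit S c d = 0 := by
  rw [outerUnit, outerUnit, Matrix.submatrix_mul_equiv, ← Matrix.mul_kronecker_mul]
  simp [h]

lemma sum_outerUnit (S : Finset ι) : ∑ a : OuterConfig κ S, outerUnit S a a = 1 := by
  ext x y
  simp only [Matrix.sum_apply, outerUnit, Matrix.submatrix_apply, Matrix.kroneckerMap_apply]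
  rw [← Finset.mul_sum]
  simp only [Matrix.single_apply, ite_and, Finset.sum_ite_eq', Finset.mem_univ,
    if_true, Matrix.one_apply, mul_ite, mul_one, mul_zero]
  rw [← ite_and]
  simp [← Prod.ext_iff, and_comm]

lemma star_outerUnit (S : Finset ι) (a b : OuterConfig κ S) :
    star (outerUnit S a b) = outerUnit S b a := by
  simp [outerUnit, Matrix.star_eq_conjTranspose, Matrix.conjTranspose_kronecker]

lemma outerUnit_commute {S : Finset ι} (a b : OuterConfig κ S) {X : Op κ} (hX : X ∈ loc κ S) :
    Commute (outerUnit S a b) X := by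
  obtain ⟨M, rfl⟩ := exists_eq_extend hX
  rw [Commute, SemiconjBy, outerUnit, extend, Matrix.submatrix_mul_equiv,
    Matrix.submatrix_mul_equiv, ← Matrix.mul_kronecker_mul, ← Matrix.mul_kronecker_mul]
  simp

lemma outerUnit_mem_loc {S T : Finset ι} (hST : ∀ i ∉ S, i ∈ T) (a b : OuterConfig κ S) :
    outerUnit S a b ∈ loc κ T :=
  mem_loc.2 fun i hi c d => (outerUnit_commute a b
    (siteUnit_mem_loc (by by_contra h; exact hi (hST i h)) c d)).symm

/-- The partial trace over the subsystems outside of `S`, followed by tensoring with `I`. -/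
def twirl (S : Finset ι) (X : Op κ) : Op κ := extend S (reduced S X)

lemma outerUnit_mul_apply (S : Finset ι) (a b : OuterConfig κ S) (X : Op κ) (x y : Config κ) :
    (outerUnit S a b * X) x y =
      if (split κ S x).2 = a then X ((split κ S).symm ((split κ S x).1, b)) y else 0 := by
  rw [Matrix.mul_apply, Finset.sum_eq_single ((split κ S).symm ((split κ S x).1, b))]
  · simp [outerUnit, Matrix.single_apply, eq_comm]
  · intro z _ hz
    rw [outerUnit, Matrix.submatrix_apply, Matrix.kroneckerMap_apply, Matrix.one_apply,
      Matrix.single_apply]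
    split_ifs with h1 h2
    · exact absurd (by rw [h1, h2.2]; simp) hz
    all_goals simp
  · simp

lemma mul_outerUnit_apply (S : Finset ι) (a b : OuterConfig κ S) (X : Op κ) (x y : Config κ) :
    (X * outerUnit S a b) x y =
      if (split κ S y).2 = b then X x ((split κ S).symm ((split κ S y).1, a)) else 0 := by
  rw [Matrix.mul_apply, Finset.sum_eq_single ((split κ S).symm ((split κ S y).1, a))]
  · simp [outerUnit, Matrix.single_apply, eq_comm]
  · intro z _ hz
    rw [outerUnit, Matrix.submatrix_apply, Matrix.kroneckerMap_apply, Matrix.one_apply,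
      Matrix.single_apply]
    split_ifs with h1 h2
    · exact absurd (by rw [← h1, h2.1]; simp) hz
    all_goals simp
  · simp

lemma twirl_eq_sum (S : Finset ι) (X : Op κ) :
    twirl S X = ∑ a, ∑ b, outerUnit S a b * X * outerUnit S b a := by
  ext x y
  simp only [Matrix.sum_apply]
  simp only [mul_outerUnit_apply, outerUnit_mul_apply]
  rw [Finset.sum_eq_single (split κ S x).2]
  · simp only [twirl, extend, Matrix.submatrix_apply, Matrix.kroneckerMap_apply, reduced,
      Matrix.of_apply, Matrix.one_apply, if_true]
    by_cases h : (split κ S x).2 = (split κ S y).2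
    · simp [h]
    · simp [h, Ne.symm h]
  · intro a _ ha
    simp [ha.symm]
  · simp

lemma twirl_mem_loc (S : Finset ι) (X : Op κ) : twirl S X ∈ loc κ S := extend_mem_loc S _

lemma twirl_mul_right {S : Finset ι} (X : Op κ) {Y : Op κ} (hY : Y ∈ loc κ S) :
    twirl S (X * Y) = twirl S X * Y := by
  simp only [twirl_eq_sum, Finset.sum_mul]
  refine Finset.sum_congr rfl fun a _ => Finset.sum_congr rfl fun b _ => ?_
  simp only [mul_assoc, (outerUnit_commute b a hY).eq]

lemma twirl_mul_left {S : Finset ι} (X : Op κ) {Y : Op κ} (hY : Y ∈ loc κ S) :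
    twirl S (Y * X) = Y * twirl S X := by
  simp only [twirl_eq_sum, Finset.mul_sum]
  refine Finset.sum_congr rfl fun a _ => Finset.sum_congr rfl fun b _ => ?_
  simp only [← mul_assoc, (outerUnit_commute a b hY).eq]

lemma commute_twirl {S : Finset ι} {X Y : Op κ} (hY : Y ∈ loc κ S) (h : Commute X Y) :
    Commute (twirl S X) Y := by
  rw [Commute, SemiconjBy, ← twirl_mul_left X hY, ← twirl_mul_right X hY, h.eq]

lemma twirl_star (S : Finset ι) (X : Op κ) : twirl S (star X) = star (twirl S X) := by
  simp only [twirl_eq_sum, star_sum, star_mul, star_outerUnit, mul_assoc]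

lemma twirl_sub (S : Finset ι) (X Y : Op κ) : twirl S (X - Y) = twirl S X - twirl S Y := by
  simp only [twirl_eq_sum, mul_sub, sub_mul, Finset.sum_sub_distrib]

/-- An operator is determined by its slices. -/
lemma eq_zero_of_twirl_mul {S : Finset ι} {W : Op κ}
    (h : ∀ Y ∈ loc κ Sᶜ, twirl S (W * Y) = 0) : W = 0 := by
  -- Testing with the outer unit |c⟩⟨d| makes the partial trace pick out the (d, c) outer block of
  -- `W`.
  have key : ∀ c d : OuterConfig κ S, outerUnit S d d * W * outerUnit S c c = 0 := by
    intro c d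
    have h1 := h (outerUnit S c d) (outerUnit_mem_loc (by simp) c d)
    have h2 : outerUnit S c c * twirl S (W * outerUnit S c d) =
        outerUnit S c d * W * outerUnit S c c := by
      rw [twirl_eq_sum, Finset.mul_sum, Finset.sum_eq_single c, Finset.mul_sum,
        Finset.sum_eq_single d]
      · simp only [mul_assoc, outerUnit_mul_same]
        simp only [← mul_assoc, outerUnit_mul_same]
      · intro b _ hb
        simp only [mul_assoc, outerUnit_mul_of_ne S c d b c hb.symm, mul_zero]
      · simp
      · intro a _ ha
        rw [Finset.mul_sum]
        refine Finset.sum_eq_zero fun b _ => ?_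
        simp only [← mul_assoc, outerUnit_mul_of_ne S c c a b ha.symm, zero_mul]
      · simp
    rw [h1, mul_zero] at h2
    calc _ = outerUnit S d c * (outerUnit S c d * W * outerUnit S c c) := by
          simp only [← mul_assoc, outerUnit_mul_same]
      _ = 0 := by rw [← h2, mul_zero]
  calc W = (∑ d, outerUnit S d d) * W * ∑ c, outerUnit S c c := by simp [sum_outerUnit]
    _ = 0 := by
      rw [Finset.sum_mul, Finset.sum_mul]
      refine Finset.sum_eq_zero fun d _ => ?_
      rw [Finset.mul_sum]
      exact Finset.sum_eq_zero fun c _ => key c d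

end QuasiLocal

/-! ### Support projectors and intersections of ranges. -/

noncomputable section

namespace QuasiLocal

variable {ι : Type*} [Fintype ι] [DecidableEq ι]
  {κ : ι → Type*} [∀ i, Fintype (κ i)] [∀ i, DecidableEq (κ i)]

lemma eq_zero_of_sum_star_mul_self {α : Type*} {t : Finset α} {Y : α → Op κ}
    (h : ∑ i ∈ t, star (Y i) * Y i = 0) : ∀ i ∈ t, Y i = 0 := by
  have h1 : ∑ i ∈ t, (star (Y i) * Y i).trace = 0 := by
    rw [← Matrix.trace_sum, h, Matrix.trace_zero]
  rw [Finset.sum_eq_zero_iff_of_nonneg (f := fun i => (star (Y i) * Y i).trace)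
    (fun i _ => (Matrix.posSemidef_conjTranspose_mul_self (Y i)).trace_nonneg)] at h1
  exact fun i hi => Matrix.trace_conjTranspose_mul_self_eq_zero_iff.1 (h1 i hi)

/-- The identification of matrices with operators on the Hilbert space. -/
abbrev opEquiv (κ : ι → Type*) [∀ i, Fintype (κ i)] [∀ i, DecidableEq (κ i)] :
    Op κ ≃⋆ₐ[ℂ] (Space κ →L[ℂ] Space κ) :=
  Matrix.toEuclideanCLM (n := Config κ) (𝕜 := ℂ)

/-- The matrix of the orthogonal projector onto the range of `A`. -/
def suppMat (A : Op κ) : Op κ :=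
  (opEquiv κ).symm (suppProj A)

lemma toEuclideanCLM_suppMat (A : Op κ) :
    opEquiv κ (suppMat A) = suppProj A :=
  StarAlgEquiv.apply_symm_apply _ _

lemma isStarProjection_suppMat (A : Op κ) : IsStarProjection (suppMat A) := by
  have h : IsStarProjection (suppProj A) := isStarProjection_starProjection
  constructor
  · rw [IsIdempotentElem, suppMat, ← map_mul, h.isIdempotentElem.eq]
  · exact ((opEquiv κ).symm.map_star' _).symm.trans
      (congrArg (opEquiv κ).symm h.isSelfAdjoint.star_eq)

lemma suppMat_mul_self (A : Op κ) : suppMat A * A = A := by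
  apply EquivLike.injective (opEquiv κ)
  rw [map_mul, toEuclideanCLM_suppMat]
  ext1 v
  rw [mul_apply_eq_comp]
  exact Submodule.starProjection_eq_self_iff.2 ⟨v, rfl⟩

lemma mul_suppMat_eq_zero {A X : Op κ} (h : X * A = 0) : X * suppMat A = 0 := by
  apply EquivLike.injective (opEquiv κ)
  rw [map_mul, toEuclideanCLM_suppMat, map_zero]
  ext1 v
  rw [mul_apply_eq_comp]
  obtain ⟨w, hw⟩ : suppProj A v ∈ LinearMap.range
    (Matrix.toEuclideanCLM (n := Config κ) (𝕜 := ℂ) A).toLinearMap :=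
      Submodule.starProjection_apply_mem _ v
  rw [← hw]
  change opEquiv κ X (opEquiv κ A w) = 0
  rw [← mul_apply_eq_comp, ← map_mul, h, map_zero, zero_apply]

/-- Both `X` and its adjoint leave the range of `A` invariant, so both off-diagonal corners of `X`
vanish. -/
lemma commute_suppMat {A X : Op κ} (hA : star A = A) (h : Commute X A) :
    Commute X (suppMat A) := by
  have hs := isStarProjection_suppMat A
  have hs2 : star (suppMat A) = suppMat A := hs.isSelfAdjoint
  have hAs : A * suppMat A = A := by
    rw [← star_inj, star_mul, hs2, hA, suppMat_mul_self]
  have h1 : (1 - suppMat A) * X * suppMat A = 0 := by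
    apply mul_suppMat_eq_zero
    rw [mul_assoc, h.eq, ← mul_assoc, sub_mul, suppMat_mul_self, one_mul, sub_self, zero_mul]
  have h2 : suppMat A * X * (1 - suppMat A) = 0 := by
    rw [← star_inj, star_mul, star_mul, hs2, star_zero, ← mul_assoc]
    apply mul_suppMat_eq_zero
    rw [← star_inj, star_mul, star_mul, star_star, star_star, hA, star_zero, ← mul_assoc, ← h.eq,
      mul_assoc, mul_sub, hAs, mul_one, sub_self, mul_zero]
  rw [sub_mul, sub_mul, one_mul, sub_eq_zero] at h1
  rw [mul_sub, mul_one, sub_eq_zero] at h2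
  exact h1.trans h2.symm

lemma isStarProjection_mul_self {p : Op κ} (hp : IsStarProjection p) : p * p = p :=
  hp.isIdempotentElem

lemma isStarProjection_star {p : Op κ} (hp : IsStarProjection p) : star p = p :=
  hp.isSelfAdjoint

/-- The orthogonal projector onto the support of the partial trace of `P` outside of `S`,
tensored with `I`. -/
def locSupp (S : Finset ι) (P : Op κ) : Op κ := suppMat (twirl S P)

section locSupp

variable {S : Finset ι} {P : Op κ}

lemma isStarProjection_locSupp (S : Finset ι) (P : Op κ) : IsStarProjection (locSupp S P) :=
  isStarProjection_suppMat _

lemma commute_locSupp (hP : star P = P) {Y : Op κ} (hY : Y ∈ loc κ S) (h : Commute Y P) :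
    Commute Y (locSupp S P) :=
  commute_suppMat (by rw [← twirl_star, hP]) (commute_twirl hY h.symm).symm

lemma locSupp_mem_loc_of_forall (hP : star P = P) : locSupp S P ∈ loc κ S :=
  mem_loc.2 fun _ hi a b => commute_suppMat (by rw [← twirl_star, hP])
    (mem_loc.1 (twirl_mem_loc S P) _ hi a b)

/-- The matrix units of a site of `S` outside `R` commute with `P`, hence with its support on `S`.
This lets `S` be enlarged freely off `R` without enlarging the region of the support. -/
lemma locSupp_mem_loc_inter (hP : star P = P) {R : Finset ι} (hR : P ∈ loc κ R) :
    locSupp S P ∈ loc κ (S ∩ R) := by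
  refine mem_loc_inter (locSupp_mem_loc_of_forall hP) (mem_loc.2 fun i hi a b => ?_)
  by_cases h : i ∈ S
  · exact commute_locSupp hP (siteUnit_mem_loc h a b) (mem_loc.1 hR i hi a b)
  · exact mem_loc.1 (locSupp_mem_loc_of_forall hP) i h a b

/-- The partial trace is faithful on positive operators: that of (XP)(XP)† is X (Tr P) X† = 0, and
it is a sum of squares. -/
lemma mul_eq_zero_of_twirl (hP : IsStarProjection P) {X : Op κ} (hX : X ∈ loc κ S)
    (h : X * twirl S P = 0) : X * P = 0 := by
  have h1 : twirl S ((X * P) * star (X * P)) = 0 := by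
    rw [star_mul, isStarProjection_star hP, mul_assoc, ← mul_assoc P, isStarProjection_mul_self hP,
      twirl_mul_left _ hX, twirl_mul_right _ (star_mem hX), ← mul_assoc, h, zero_mul]
  have h2 : ∀ a b, star (X * P) * outerUnit S b a = 0 := by
    rw [twirl_eq_sum, ← Finset.sum_product'] at h1
    intro a b
    refine eq_zero_of_sum_star_mul_self (t := Finset.univ ×ˢ Finset.univ)
      (Y := fun ab : OuterConfig κ S × OuterConfig κ S => star (X * P) * outerUnit S ab.2 ab.1)
      ?_ (a, b) (by simp)
    rw [← h1]
    refine Finset.sum_congr rfl fun ab _ => ?_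
    simp only [star_mul, star_star, star_outerUnit, mul_assoc]
  have h3 : star (X * P) = 0 := by
    rw [← mul_one (star (X * P)), ← sum_outerUnit S, Finset.mul_sum]
    exact Finset.sum_eq_zero fun a _ => h2 a a
  rwa [star_eq_zero] at h3

lemma locSupp_mul (hP : IsStarProjection P) : locSupp S P * P = P := by
  have h : (1 - locSupp S P) * P = 0 := by
    refine mul_eq_zero_of_twirl hP
      (sub_mem (one_mem _) (locSupp_mem_loc_of_forall (isStarProjection_star hP))) ?_
    rw [sub_mul, one_mul, locSupp, suppMat_mul_self, sub_self]
  rw [sub_mul, one_mul, sub_eq_zero] at h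
  exact h.symm

/-- The locality principle: a local `X` passes through the partial trace, so it kills the reduced
operator and with it the range. -/
lemma mul_locSupp_eq_zero {X : Op κ} (hX : X ∈ loc κ S) (h : X * P = 0) :
    X * locSupp S P = 0 := by
  refine mul_suppMat_eq_zero ?_
  rw [← twirl_mul_left _ hX, h]
  have := twirl_sub S P P
  rwa [sub_self, sub_self] at this

end locSupp

/-- The orthogonal projector onto the intersection of the ranges of the projectors `f i`. -/
def meet {α : Type*} (t : Finset α) (f : α → Op κ) : Op κ := 1 - suppMat (∑ i ∈ t, (1 - f i))

section meet

variable {α : Type*} {t : Finset α} {f : α → Op κ}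

lemma isStarProjection_meet (t : Finset α) (f : α → Op κ) : IsStarProjection (meet t f) :=
  (isStarProjection_suppMat _).one_sub

lemma star_sum_one_sub (hf : ∀ i ∈ t, IsStarProjection (f i)) :
    star (∑ i ∈ t, (1 - f i)) = ∑ i ∈ t, (1 - f i) := by
  rw [star_sum]
  exact Finset.sum_congr rfl fun i hi => isStarProjection_star (hf i hi).one_sub

lemma commute_meet (hf : ∀ i ∈ t, IsStarProjection (f i)) {X : Op κ}
    (h : ∀ i ∈ t, Commute X (f i)) : Commute X (meet t f) :=
  (Commute.one_right X).sub_right (commute_suppMat (star_sum_one_sub hf)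
    (Commute.sum_right _ _ _ fun i hi => (Commute.one_right X).sub_right (h i hi)))

lemma mul_meet (hf : ∀ i ∈ t, IsStarProjection (f i)) {i : α} (hi : i ∈ t) :
    f i * meet t f = meet t f := by
  set H := ∑ i ∈ t, (1 - f i) with hH
  have hm := isStarProjection_meet t f
  have h1 : H * meet t f = 0 := by
    have hs := isStarProjection_star (isStarProjection_suppMat H)
    have : H * suppMat H = H := by
      rw [← star_inj, star_mul, hs, star_sum_one_sub hf, suppMat_mul_self]
    rw [meet, mul_sub, mul_one, ← hH, this, sub_self]
  -- The projectors need not commute: a vector of zero total energy has zero energy for each term,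
  -- because the energy is a sum of squares.
  have h2 : ∑ i ∈ t, star ((1 - f i) * meet t f) * ((1 - f i) * meet t f) = 0 := by
    rw [← mul_zero (star (meet t f)), ← h1, hH, Finset.sum_mul, Finset.mul_sum]
    refine Finset.sum_congr rfl fun i hi => ?_
    have hp := (hf i hi).one_sub
    rw [star_mul, isStarProjection_star hp, mul_assoc, ← mul_assoc (1 - f i),
      isStarProjection_mul_self hp]
  have h3 := eq_zero_of_sum_star_mul_self h2 i hi
  rw [sub_mul, one_mul, sub_eq_zero] at h3
  exact h3.symm

lemma meet_mul (hf : ∀ i ∈ t, IsStarProjection (f i)) {X : Op κ}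
    (h : ∀ i ∈ t, f i * X = X) : meet t f * X = X := by
  have h1 : (∑ i ∈ t, (1 - f i)) * X = 0 := by
    rw [Finset.sum_mul]
    exact Finset.sum_eq_zero fun i hi => by rw [sub_mul, one_mul, h i hi, sub_self]
  have h2 : star X * suppMat (∑ i ∈ t, (1 - f i)) = 0 := by
    apply mul_suppMat_eq_zero
    rw [← star_inj, star_mul, star_star, star_sum_one_sub hf, h1, star_zero]
  have h3 : suppMat (∑ i ∈ t, (1 - f i)) * X = 0 := by
    rw [← star_inj, star_mul, isStarProjection_star (isStarProjection_suppMat _), h2, star_zero]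
  rw [meet, sub_mul, one_mul, h3, sub_zero]

lemma meet_mem_loc (hf : ∀ i ∈ t, IsStarProjection (f i)) {R : Finset ι}
    (h : ∀ i ∈ t, f i ∈ loc κ R) : meet t f ∈ loc κ R :=
  mem_loc.2 fun _ hi a b => commute_meet hf fun j hj => mem_loc.1 (h j hj) _ hi a b

end meet

end QuasiLocal

end

/-! ### Necessity: orthogonality of complementary ground spaces up to the target state. -/

noncomputable section

namespace QuasiLocal

variable {ι : Type*} [Fintype ι] [DecidableEq ι]
  {κ : ι → Type*} [∀ i, Fintype (κ i)] [∀ i, DecidableEq (κ i)]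

lemma dotProduct_star_self {ψ : Space κ} (hψ : ‖ψ‖ = 1) : star ψ.ofLp ⬝ᵥ ψ.ofLp = 1 := by
  have h := inner_self_eq_norm_sq_to_K (𝕜 := ℂ) ψ
  rw [hψ, EuclideanSpace.inner_eq_star_dotProduct, dotProduct_comm] at h
  simpa using h

lemma pureState_mul_mul (ψ : Space κ) (X : Op κ) :
    pureState ψ * X * pureState ψ = (star ψ.ofLp ⬝ᵥ X *ᵥ ψ.ofLp) • pureState ψ := by
  rw [pureState, mul_assoc, Matrix.mul_vecMulVec, Matrix.vecMulVec_mul_vecMulVec]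
  ext x y
  simp [Matrix.vecMulVec_apply]
  ring

lemma isStarProjection_pureState {ψ : Space κ} (hψ : ‖ψ‖ = 1) :
    IsStarProjection (pureState ψ) := by
  constructor
  · have h := pureState_mul_mul ψ 1
    rwa [mul_one, Matrix.one_mulVec, dotProduct_star_self hψ, one_smul] at h
  · rw [IsSelfAdjoint, pureState, Matrix.star_eq_conjTranspose, Matrix.conjTranspose_vecMulVec,
      star_star]

lemma trace_pureState {ψ : Space κ} (hψ : ‖ψ‖ = 1) : (pureState ψ).trace = 1 := by
  rw [pureState, Matrix.trace_vecMulVec, dotProduct_comm, dotProduct_star_self hψ]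

lemma pureState_mul_mul_eq_trace {ψ : Space κ} (hψ : ‖ψ‖ = 1) (X : Op κ) :
    pureState ψ * X * pureState ψ = (pureState ψ * X * pureState ψ).trace • pureState ψ := by
  conv_rhs => rw [pureState_mul_mul, Matrix.trace_smul, trace_pureState hψ, smul_eq_mul, mul_one]
  exact pureState_mul_mul ψ X

lemma pureState_ne_zero {ψ : Space κ} (hψ : ‖ψ‖ = 1) : pureState ψ ≠ 0 := fun h => by
  have := trace_pureState hψ
  simp [h] at this

lemma eq_zero_of_forall_mul_mul {W R : Op κ} (hR : R ≠ 0) (h : ∀ Y, W * Y * R = 0) : W = 0 := by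
  obtain ⟨a, b, hab⟩ : ∃ a b, R a b ≠ 0 := by
    by_contra! hc
    exact hR (by ext a b; exact hc a b)
  ext z x
  have h1 := congrFun (congrFun (h (Matrix.single x a 1)) z) b
  rw [mul_assoc, Matrix.mul_apply, Finset.sum_eq_single x] at h1
  · simpa [hab] using h1
  · intro y _ hy
    rw [Matrix.single_mul_apply_of_ne _ _ _ _ _ hy, mul_zero]
  · simp

/-- The matrix of the projector `nbhdProj ψ S`. -/
abbrev nbhdMat (ψ : Space κ) (S : Finset ι) : Op κ := locSupp S (pureState ψ)

lemma nbhdProj_eq (ψ : Space κ) (S : Finset ι) : nbhdProj ψ S = opEquiv κ (nbhdMat ψ S) :=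
  (toEuclideanCLM_suppMat _).symm

/-- The hypothesis makes ψ an eigenvector of `X`, with eigenvalue c; then X − c is local and kills
ψ, so the locality principle applies to it. -/
lemma exists_mul_locSupp_eq_smul {ψ : Space κ} (hψ : ‖ψ‖ = 1) {S : Finset ι} {X : Op κ}
    (hX : X ∈ loc κ S) (h : (1 - pureState ψ) * X * pureState ψ = 0) :
    ∃ c : ℂ, X * pureState ψ = c • pureState ψ ∧ X * nbhdMat ψ S = c • nbhdMat ψ S := by
  refine ⟨(pureState ψ * X * pureState ψ).trace, ?_⟩
  set c := (pureState ψ * X * pureState ψ).trace with hc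
  have h1 : X * pureState ψ = c • pureState ψ := by
    rw [hc, ← pureState_mul_mul_eq_trace hψ, ← sub_eq_zero, ← h, sub_mul, sub_mul, one_mul]
  refine ⟨h1, ?_⟩
  have h2 : (X - c • (1 : Op κ)) * nbhdMat ψ S = 0 := by
    refine mul_locSupp_eq_zero (sub_mem hX (SMulMemClass.smul_mem c (one_mem _))) ?_
    rw [sub_mul, h1, smul_mul_assoc, one_mul, sub_self]
  rwa [sub_mul, smul_mul_assoc, one_mul, sub_eq_zero] at h2

section Kraus

variable {r : ℕ} {M : Fin r → Op κ} {E : Op κ →ₗ[ℂ] Op κ} {P : Op κ} {c : Fin r → ℂ}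

/-- The Kraus operators of a map that preserves a pure state have this state as an eigenvector. -/
lemma kraus_mul_eq_zero {R : Op κ} (hR : IsStarProjection R)
    (hE : ∀ X, E X = ∑ k, M k * X * star (M k)) (h : E R = R) (k : Fin r) :
    (1 - R) * M k * R = 0 := by
  -- The complementary corner of E(R) = R vanishes, and it is a sum of positive terms.
  have h1 : ∑ k, star (star ((1 - R) * M k * R)) * star ((1 - R) * M k * R) = 0 := by
    have h0 : (1 - R) * E R * (1 - R) = 0 := by
      rw [h, sub_mul 1 R R, one_mul, isStarProjection_mul_self hR, sub_self, zero_mul]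
    rw [← h0, hE, Finset.mul_sum, Finset.sum_mul]
    refine Finset.sum_congr rfl fun k _ => ?_
    simp only [star_star, star_mul, isStarProjection_star hR, isStarProjection_star hR.one_sub,
      mul_assoc]
    rw [← mul_assoc R R, isStarProjection_mul_self hR]
  have h2 := eq_zero_of_sum_star_mul_self h1 k (Finset.mem_univ k)
  rwa [star_eq_zero] at h2

/-- Since P Mₖ† = c̄ₖ P, the right-hand Kraus factors collapse to scalars and L = ∑ c̄ₖ Mₖ. Trace
preservation gives P L = ∑ P Mₖ† Mₖ = P. In this form the maps can be composed. -/
lemma exists_left_mul_of_kraus (hP : IsStarProjection P) (hM : ∑ k, star (M k) * M k = 1)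
    (hE : ∀ X, E X = ∑ k, M k * X * star (M k)) (hc : ∀ k, M k * P = c k • P) :
    ∃ L, P * L = P ∧ ∀ X, E (X * P) = L * X * P := by
  have hc' : ∀ k, P * star (M k) = star (c k) • P := fun k => by
    rw [← star_inj, star_mul, star_star, isStarProjection_star hP, hc, star_smul, star_star,
      isStarProjection_star hP]
  refine ⟨∑ k, star (c k) • M k, ?_, fun X => ?_⟩
  · rw [Finset.mul_sum]
    calc ∑ k, P * star (c k) • M k = ∑ k, P * (star (M k) * M k) := by
          refine Finset.sum_congr rfl fun k _ => ?_
          rw [← mul_assoc, hc', mul_smul_comm, smul_mul_assoc]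
      _ = P := by rw [← Finset.mul_sum, hM, mul_one]
  · rw [hE, Finset.sum_mul, Finset.sum_mul]
    refine Finset.sum_congr rfl fun k _ => ?_
    rw [mul_assoc, mul_assoc, hc', mul_smul_comm, mul_smul_comm, smul_mul_assoc, smul_mul_assoc,
      mul_assoc]

/-- Here L P = (∑ |cₖ|²) P, and P L = P forces this to equal P. -/
lemma kraus_apply_corner (hP : IsStarProjection P) (hM : ∑ k, star (M k) * M k = 1)
    (hE : ∀ X, E X = ∑ k, M k * X * star (M k)) (hc : ∀ k, M k * P = c k • P) (X : Op κ) :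
    E (P * X * P) = P * X * P := by
  obtain ⟨L, hL, hEL⟩ := exists_left_mul_of_kraus hP hM hE hc
  have hL2 : L * P = (∑ k, star (c k) * c k) • P := by
    have hc' : ∀ k, P * star (M k) = star (c k) • P := fun k => by
      rw [← star_inj, star_mul, star_star, isStarProjection_star hP, hc, star_smul, star_star,
        isStarProjection_star hP]
    have h := hEL P
    rw [mul_assoc, isStarProjection_mul_self hP] at h
    rw [← h, hE, Finset.sum_smul]
    refine Finset.sum_congr rfl fun k _ => ?_
    rw [hc, smul_mul_assoc, hc', smul_smul, mul_comm]
  have h3 : (∑ k, star (c k) * c k) • P = P := by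
    rw [← isStarProjection_mul_self hP, ← mul_smul_comm, ← hL2, ← mul_assoc, hL]
  rw [hEL, ← mul_assoc, hL2, h3]

end Kraus

lemma exists_left_mul_foldl {P : Op κ} {l : List (Op κ →ₗ[ℂ] Op κ)}
    (h : ∀ F ∈ l, ∃ L, P * L = P ∧ ∀ X, F (X * P) = L * X * P) :
    ∃ L, P * L = P ∧ ∀ X, l.foldl (fun Y F => F Y) (X * P) = L * X * P := by
  induction l with
  | nil => exact ⟨1, by simp, by simp⟩
  | cons F l ih =>
    obtain ⟨L₁, h₁, h₁'⟩ := h F (by simp)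
    obtain ⟨L₂, h₂, h₂'⟩ := ih fun G hG => h G (by simp [hG])
    refine ⟨L₂ * L₁, by rw [← mul_assoc, h₂, h₁], fun X => ?_⟩
    rw [List.foldl_cons, h₁', h₂', mul_assoc L₂ L₁ X]

lemma foldl_eq_self {l : List (Op κ →ₗ[ℂ] Op κ)} {X : Op κ} (h : ∀ F ∈ l, F X = X) :
    l.foldl (fun Y F => F Y) X = X := by
  induction l with
  | nil => rfl
  | cons F l ih =>
    rw [List.foldl_cons, h F (by simp)]
    exact ih fun G hG => h G (by simp [hG])

lemma exists_linearMap_foldl (l : List (Op κ →ₗ[ℂ] Op κ)) :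
    ∃ F : Op κ →ₗ[ℂ] Op κ, ∀ X, l.foldl (fun Y F => F Y) X = F X := by
  induction l with
  | nil => exact ⟨LinearMap.id, fun _ => rfl⟩
  | cons G l ih =>
    obtain ⟨F, hF⟩ := ih
    exact ⟨F ∘ₗ G, fun X => hF (G X)⟩

/-- A linear map is determined by its values on the density operators. -/
lemma eq_trace_smul_of_density {F : Op κ →ₗ[ℂ] Op κ} {R : Op κ}
    (h : ∀ σ, IsDensity σ → F σ = R) (X : Op κ) : F X = X.trace • R := by
  have h1 : ∀ A : Op κ, F (A * star A) = (A * star A).trace • R := by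
    intro A
    have hA : (A * star A).PosSemidef := Matrix.posSemidef_self_mul_conjTranspose A
    by_cases h0 : (A * star A).trace = 0
    · have : A = 0 := Matrix.trace_mul_conjTranspose_self_eq_zero_iff.1 h0
      simp [this]
    · have hpos : 0 ≤ (A * star A).trace⁻¹ := by
        rw [inv_nonneg]
        exact hA.trace_nonneg
      have h2 := h ((A * star A).trace⁻¹ • (A * star A))
        ⟨hA.smul hpos, by rw [Matrix.trace_smul, smul_eq_mul, inv_mul_cancel₀ h0]⟩
      rw [map_smul, inv_smul_eq_iff₀ h0] at h2
      exact h2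
  -- Polarization of the sesquilinear form (A, B) ↦ A B† at (X, 1).
  have h4 : (4 : ℂ) • X = (X + 1) * star (X + 1) - (X - 1) * star (X - 1)
      + Complex.I • ((X + Complex.I • 1) * star (X + Complex.I • 1))
      - Complex.I • ((X - Complex.I • 1) * star (X - Complex.I • 1)) := by
    simp only [star_add, star_sub, star_one, star_smul, Complex.star_def, Complex.conj_I, add_mul,
      mul_add, sub_mul, mul_sub, smul_add, smul_sub, smul_mul_assoc, mul_smul_comm, smul_smul,
      mul_one, one_mul, neg_smul, smul_neg, Complex.I_mul_I, mul_neg]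
    module
  have h5 : F ((4 : ℂ) • X) = ((4 : ℂ) • X).trace • R := by
    rw [h4]
    simp only [map_add, map_sub, map_smul, h1, Matrix.trace_add, Matrix.trace_sub,
      Matrix.trace_smul, add_smul, sub_smul, smul_eq_mul, mul_smul]
  rw [map_smul, Matrix.trace_smul, smul_eq_mul, mul_smul] at h5
  exact smul_right_injective _ (by norm_num : (4 : ℂ) ≠ 0) h5

/-- Turns an order of application, given as a list, into the permutation over which robustness
quantifies. -/
lemma exists_perm_ofFn_eq {T : ℕ} {l : List (Fin T)} (hl : l.Perm (List.finRange T)) :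
    ∃ p : Equiv.Perm (Fin T), List.ofFn p = l := by
  have hlen : l.length = T := by simpa using hl.length_eq
  have hnd : l.Nodup := hl.nodup_iff.2 (List.nodup_finRange T)
  refine ⟨(finCongr hlen.symm).trans (hnd.getEquivOfForallMemList l fun x =>
    hl.mem_iff.2 (List.mem_finRange x)), ?_⟩
  exact List.ext_getElem (by simp [hlen]) fun i h₁ h₂ => by simp

/-- Robust finite-time stabilizability forces the ground spaces of complementary families of
neighborhoods to be orthogonal up to the target state. -/
lemma meet_mul_meet_of_isRFTS {𝒩 : NeighborhoodStructure ι} {ψ : Space κ} (hψ : ‖ψ‖ = 1)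
    (h : IsRFTS 𝒩 (pureState ψ)) {A B : Finset (Finset ι)} (hAB : 𝒩.sets ⊆ A ∪ B) :
    meet B (nbhdMat ψ) * meet A (nbhdMat ψ) = pureState ψ := by
  obtain ⟨T, E, hloc, hfix, hconv⟩ := h
  choose S hS hE using hloc
  have hρ := isStarProjection_pureState hψ
  have hproj : ∀ C : Finset (Finset ι), ∀ i ∈ C, IsStarProjection (nbhdMat ψ i) :=
    fun C i _ => isStarProjection_locSupp i _
  have hmeetρ : ∀ C : Finset (Finset ι), pureState ψ * meet C (nbhdMat ψ) = pureState ψ := by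
    intro C
    rw [← star_inj, star_mul, isStarProjection_star (isStarProjection_meet _ _),
      isStarProjection_star hρ]
    exact meet_mul (hproj C) fun i _ => locSupp_mul hρ
  have key : ∀ (C : Finset (Finset ι)) (t : Fin T), S t ∈ C →
      (∃ L, meet C (nbhdMat ψ) * L = meet C (nbhdMat ψ) ∧
        ∀ X, E t (X * meet C (nbhdMat ψ)) = L * X * meet C (nbhdMat ψ)) ∧
      ∀ X, E t (meet C (nbhdMat ψ) * X * meet C (nbhdMat ψ)) =
        meet C (nbhdMat ψ) * X * meet C (nbhdMat ψ) := by
    intro C t ht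
    obtain ⟨r, M, hM, hEM⟩ := hE t
    have hM' : ∑ k, star (extend (S t) (M k)) * extend (S t) (M k) = 1 := hM
    have hEM' : ∀ X, E t X = ∑ k, extend (S t) (M k) * X * star (extend (S t) (M k)) := hEM
    have hc : ∀ k, ∃ c : ℂ, extend (S t) (M k) * meet C (nbhdMat ψ) = c • meet C (nbhdMat ψ) := by
      intro k
      obtain ⟨c, -, hc⟩ := exists_mul_locSupp_eq_smul hψ (extend_mem_loc (S t) (M k))
        (kraus_mul_eq_zero hρ hEM' (hfix t) k)
      refine ⟨c, ?_⟩
      rw [← mul_meet (hproj C) ht, ← mul_assoc, hc, smul_mul_assoc]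
    choose c hc using hc
    exact ⟨exists_left_mul_of_kraus (isStarProjection_meet _ _) hM' hEM' hc,
      kraus_apply_corner (isStarProjection_meet _ _) hM' hEM' hc⟩
  -- The order that runs the maps on neighborhoods of `A` first. The others belong to `B`, since the
  -- two families cover.
  obtain ⟨p, hp⟩ := exists_perm_ofFn_eq
    (List.filter_append_perm (fun t => decide (S t ∈ A)) (List.finRange T))
  have hev : ∀ X, evolve (fun t => E (p t)) X =
      (((List.finRange T).filter fun t => !decide (S t ∈ A)).map E).foldl (fun Y F => F Y)
      ((((List.finRange T).filter fun t => decide (S t ∈ A)).map E).foldl (fun Y F => F Y) X) := by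
    intro X
    rw [evolve, ← List.foldl_append, ← List.map_append, ← hp, List.map_ofFn]
    rfl
  obtain ⟨L, hL, hLX⟩ := exists_left_mul_foldl (P := meet B (nbhdMat ψ))
    (l := ((List.finRange T).filter fun t => !decide (S t ∈ A)).map E) (by
      intro F hF
      obtain ⟨t, ht, rfl⟩ := List.mem_map.1 hF
      refine (key B t ?_).1
      have h1 := (List.mem_filter.1 ht).2
      simp only [Bool.not_eq_true', decide_eq_false_iff_not] at h1
      exact (Finset.mem_union.1 (hAB (hS t))).resolve_left h1)
  obtain ⟨F, hF⟩ := exists_linearMap_foldl (List.ofFn fun t => E (p t))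
  have htr := eq_trace_smul_of_density (F := F) (R := pureState ψ)
    (fun σ hσ => by rw [← hF]; exact hconv p σ hσ)
  rw [← sub_eq_zero]
  refine eq_zero_of_forall_mul_mul (pureState_ne_zero hψ) fun Y => ?_
  -- The test operator P(A) Y ρ lies in the corner of P(A), so the first batch fixes it. Since ρ
  -- P(B) = ρ, the second batch acts on it as left multiplication by L.
  have h1 : F (meet A (nbhdMat ψ) * Y * pureState ψ) =
      L * (meet A (nbhdMat ψ) * Y * pureState ψ) := by
    rw [← hF]
    change evolve (fun t => E (p t)) _ = _
    have h2 : meet A (nbhdMat ψ) * Y * pureState ψ =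
        meet A (nbhdMat ψ) * (Y * pureState ψ) * meet A (nbhdMat ψ) := by
      rw [mul_assoc, mul_assoc, mul_assoc, hmeetρ]
    rw [hev, foldl_eq_self (X := meet A (nbhdMat ψ) * Y * pureState ψ)]
    · conv_lhs => rw [← hmeetρ B, ← mul_assoc, hLX]
      rw [mul_assoc, mul_assoc, hmeetρ]
    · intro G hG
      obtain ⟨t, ht, rfl⟩ := List.mem_map.1 hG
      have h3 := (List.mem_filter.1 ht).2
      rw [h2]
      exact (key A t (by simpa using h3)).2 _
  rw [htr] at h1
  have h4 : (meet A (nbhdMat ψ) * Y * pureState ψ).trace =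
      (pureState ψ * Y * pureState ψ).trace := by
    nth_rewrite 1 [← isStarProjection_mul_self hρ]
    rw [← mul_assoc, Matrix.trace_mul_comm, ← mul_assoc, ← mul_assoc, hmeetρ]
  -- Multiplying by P(B) removes the unknown L and leaves P(B) P(A) Y ρ = ρ Y ρ.
  have h5 := congrArg (meet B (nbhdMat ψ) * ·) h1
  simp only [mul_smul_comm] at h5
  rw [h4, ← mul_assoc, hL, meet_mul (hproj B) (fun i _ => locSupp_mul hρ),
    ← pureState_mul_mul_eq_trace hψ] at h5
  rw [sub_mul, sub_mul, h5, sub_eq_zero]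
  simp only [mul_assoc]

end QuasiLocal

end

/-! ### Cuts of a neighborhood structure without cycles. -/

namespace NeighborhoodStructure

variable {ι : Type*} [Fintype ι] [DecidableEq ι]

/-- Two neighborhoods are adjacent off `v` if they share a subsystem outside of `v`. -/
def overlapGraph (𝒩 : NeighborhoodStructure ι) (v : Finset ι) : SimpleGraph (Finset ι) where
  Adj A B := A ≠ B ∧ A ∈ 𝒩.sets ∧ B ∈ 𝒩.sets ∧ ∃ i ∉ v, i ∈ A ∧ i ∈ B
  symm := ⟨fun _ _ ⟨h, hA, hB, i, hi, hiA, hiB⟩ => ⟨h.symm, hB, hA, i, hi, hiB, hiA⟩⟩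
  loopless := ⟨fun _ h => h.1 rfl⟩

/-- Without cycle paths, two overlapping neighborhoods are disconnected by the removal of their
intersection. -/
lemma not_reachable_overlapGraph {𝒩 : NeighborhoodStructure ι}
    (h : ∀ m j k, ¬ 𝒩.IsCyclePath m j k) {A B : Finset ι} (hA : A ∈ 𝒩.sets)
    (hAB : A ≠ B) {i₀ : ι} (hi₀ : i₀ ∈ A ∩ B) :
    ¬ (𝒩.overlapGraph (A ∩ B)).Reachable A B := by
  intro hr
  set G := 𝒩.overlapGraph (A ∩ B) with hG
  obtain ⟨w, hw⟩ := hr.exists_walk_length_eq_dist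
  set r := w.length with hrdef
  have hupper : ∀ l, (G.dist A (w.getVert l)) ≤ l := fun l => by
    refine (SimpleGraph.dist_le (w.take l)).trans ?_
    simp
  have hreach : ∀ l, G.Reachable A (w.getVert l) := fun l => ⟨w.take l⟩
  -- On a shortest walk, position equals distance from `A`; hence its neighborhoods are distinct,
  -- and nonconsecutive ones share nothing off A ∩ B.
  have hdist : ∀ l ≤ r, G.dist A (w.getVert l) = l := by
    intro l hl
    refine le_antisymm (hupper l) ?_
    obtain ⟨q, hq⟩ := (hreach l).exists_walk_length_eq_dist
    have h1 := SimpleGraph.dist_le (q.append (w.drop l))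
    rw [SimpleGraph.Walk.length_append, SimpleGraph.Walk.drop_length, hq, ← hw] at h1
    omega
  have hadj : ∀ {a b}, a ≤ r → b ≤ r → a < b → ∀ i ∉ A ∩ B, i ∈ w.getVert a →
      i ∈ w.getVert b → w.getVert a ∈ 𝒩.sets → w.getVert b ∈ 𝒩.sets → b ≤ a + 1 := by
    intro a b ha hb hab i hi hia hib hsa hsb
    have hne : w.getVert a ≠ w.getVert b := fun he => by
      have := hdist a ha
      rw [he, hdist b hb] at this
      omega
    obtain ⟨q, hq⟩ := (hreach a).exists_walk_length_eq_dist
    have h1 := SimpleGraph.dist_le (q.concat (show G.Adj _ _ from ⟨hne, hsa, hsb, i, hi, hia, hib⟩))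
    rw [SimpleGraph.Walk.length_concat, hq, hdist a ha, hdist b hb] at h1
    exact h1
  have hsucc : ∀ l : ℕ, ∃ i, l < r → i ∉ A ∩ B ∧ i ∈ w.getVert l ∧ i ∈ w.getVert (l + 1) ∧
      w.getVert (l + 1) ∈ 𝒩.sets := by
    intro l
    by_cases hl : l < r
    · obtain ⟨-, -, h2, i, hi, hi1, hi2⟩ := w.adj_getVert_succ hl
      exact ⟨i, fun _ => ⟨hi, hi1, hi2, h2⟩⟩
    · exact ⟨i₀, fun h => absurd h hl⟩
  choose f hf using hsucc
  have hsets : ∀ l ≤ r, w.getVert l ∈ 𝒩.sets := by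
    intro l hl
    cases l with
    | zero => simpa using hA
    | succ l => exact (hf l hl).2.2.2
  have hrpos : 0 < r := by
    rcases Nat.eq_zero_or_pos r with h0 | h0
    · exact absurd (SimpleGraph.Walk.eq_of_length_eq_zero h0) hAB
    · exact h0
  have hBsets : B ∈ 𝒩.sets := by simpa [hrdef] using hsets r le_rfl
  rw [Finset.mem_inter] at hi₀
  -- The walk from `A` to `B`, through subsystems shared by consecutive neighborhoods, is closed up
  -- at i₀ ∈ A ∩ B. It visits r + 1 ≥ 2 neighborhoods, as required of a cycle path.
  let j : Fin (r + 1 + 1) → ι := fun l => if 0 < l.1 ∧ l.1 ≤ r then f (l.1 - 1) else i₀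
  have hj0 : ∀ l : Fin (r + 1 + 1), l.1 = 0 → j l = i₀ := fun l hl => if_neg (by omega)
  have hjr : ∀ l : Fin (r + 1 + 1), l.1 = r + 1 → j l = i₀ := fun l hl => if_neg (by omega)
  have hjm : ∀ l : Fin (r + 1 + 1), 0 < l.1 → l.1 ≤ r → j l = f (l.1 - 1) :=
    fun l h1 h2 => if_pos ⟨h1, h2⟩
  have hnot : ∀ l : Fin (r + 1 + 1), 0 < l.1 → l.1 ≤ r → j l ∉ A ∩ B := fun l h1 h2 => by
    rw [hjm l h1 h2]
    exact (hf (l.1 - 1) (by omega)).1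
  refine h (r + 1) j (fun l => w.getVert l.1) ⟨by omega, ⟨?_, ?_, ?_, ?_, ?_⟩, ?_⟩
  · intro l l' hll' hsame
    have hlt : l.1 < l'.1 := hll'
    have hl'2 := l'.2
    rcases Nat.eq_zero_or_pos l.1 with h0 | h0
    · refine ⟨Fin.ext h0, Fin.ext ?_⟩
      rw [Fin.val_last]
      by_contra hne
      refine hnot l' (by omega) (by omega) (Finset.mem_inter.2 ?_)
      rw [hj0 l h0] at hsame
      exact ⟨(hsame A hA).1 hi₀.1, (hsame B hBsets).1 hi₀.2⟩
    · exfalso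
      by_cases hne : l'.1 = r + 1
      · refine hnot l (by omega) (by omega) (Finset.mem_inter.2 ?_)
        rw [hjr l' hne] at hsame
        exact ⟨(hsame A hA).2 hi₀.1, (hsame B hBsets).2 hi₀.2⟩
      -- Two interior links in the same particle would make the neighborhood before the first
      -- adjacent to the one after the second: a shortcut.
      · rw [hjm l h0 (by omega), hjm l' (by omega) (by omega)] at hsame
        obtain ⟨h1, h2, -, -⟩ := hf (l.1 - 1) (by omega)
        obtain ⟨-, -, h3, h4⟩ := hf (l'.1 - 1) (by omega)
        have h5 := (hsame _ h4).2 h3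
        have := hadj (by omega) (by omega) (by omega) _ h1 h2 h5 (hsets _ (by omega)) h4
        omega
  · intro l l' hll'
    have h1 := hdist l.1 (by omega)
    have h2 := hdist l'.1 (by omega)
    simp only at hll'
    rw [hll'] at h1
    exact Fin.ext (h1.symm.trans h2)
  · exact fun l => hsets l.1 (by omega)
  · intro l
    rcases Nat.eq_zero_or_pos l.1 with h0 | h0
    · rw [hj0 _ (by simpa using h0), h0]
      simpa using hi₀.1
    · rw [hjm _ (by simpa using h0) (by simp; omega)]
      have := (hf (l.1 - 1) (by omega)).2.2.1
      rwa [Nat.sub_add_cancel h0] at this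
  · intro l
    by_cases h0 : l.1 = r
    · rw [hjr _ (by simp [h0]), h0]
      simpa [hrdef] using hi₀.2
    · rw [hjm _ (by simp) (by simp; omega)]
      simpa using (hf l.1 (by omega)).2.1
  · intro S _
    rw [hj0 0 rfl, hjr _ (by simp)]

/-- Without cycle paths, the neighborhoods can be divided into two families that separate two
given overlapping neighborhoods, and overlap in the intersection of these only. -/
lemma exists_cut {𝒩 : NeighborhoodStructure ι} (h : ∀ m j k, ¬ 𝒩.IsCyclePath m j k)
    {A B : Finset ι} (hA : A ∈ 𝒩.sets) (hAB : A ≠ B) {i₀ : ι}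
    (hi₀ : i₀ ∈ A ∩ B) : ∃ 𝒜 ⊆ 𝒩.sets, A ∈ 𝒜 ∧ B ∉ 𝒜 ∧
      ∀ S ∈ 𝒜, ∀ S' ∈ 𝒩.sets, S' ∉ 𝒜 → S ∩ S' ⊆ A ∩ B := by
  classical
  -- The family is the connected component of `A` once A ∩ B is removed.
  refine ⟨𝒩.sets.filter fun S => (𝒩.overlapGraph (A ∩ B)).Reachable A S,
    Finset.filter_subset _ _, ?_, ?_, ?_⟩
  · exact Finset.mem_filter.2 ⟨hA, SimpleGraph.Reachable.refl _⟩
  · exact fun hB => not_reachable_overlapGraph h hA hAB hi₀ (Finset.mem_filter.1 hB).2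
  · intro S hS S' hS' hnot i hi
    by_contra hiv
    rw [Finset.mem_filter] at hS hnot
    rw [Finset.mem_inter] at hi
    refine hnot ⟨hS', hS.2.trans (SimpleGraph.Adj.reachable ⟨?_, hS.1, hS', i, hiv, hi.1, hi.2⟩)⟩
    rintro rfl
    exact hnot hS

end NeighborhoodStructure

/-! ### Commutation of the local supports across a cut. -/

noncomputable section

namespace QuasiLocal

variable {ι : Type*} [Fintype ι] [DecidableEq ι]
  {κ : ι → Type*} [∀ i, Fintype (κ i)] [∀ i, DecidableEq (κ i)]

section Cut

variable {ψ : Space κ} {P Q : Op κ} {R R' v N : Finset ι}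

/-- If the pure state is the product of two commuting projections that act on regions
overlapping in `v`, then its local support projector factorizes. -/
lemma nbhdMat_eq_mul (hψ : ‖ψ‖ = 1) (hP : IsStarProjection P) (hQ : IsStarProjection Q)
    (hPR : P ∈ loc κ R) (hQR : Q ∈ loc κ R') (hPQ : P * Q = pureState ψ) (hcomm : Commute P Q)
    (hv : R ∩ R' ⊆ v) (hN : N ⊆ R) (hvN : v ⊆ N) :
    Commute Q (locSupp (N ∪ Rᶜ) P) ∧
      Commute (locSupp (v ∪ R'ᶜ) Q) (locSupp (N ∪ Rᶜ) P) ∧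
      nbhdMat ψ N = locSupp (N ∪ Rᶜ) P * locSupp (v ∪ R'ᶜ) Q := by
  have hρ := isStarProjection_pureState hψ
  set p := locSupp (N ∪ Rᶜ) P with hp
  set b := locSupp (v ∪ R'ᶜ) Q with hb
  -- Adding Rᶜ to N leaves the support of P acting on N only, yet makes all of Q local for the
  -- locality principle. The next inclusion does the same with P and Q exchanged.
  have hR'N : R' ⊆ N ∪ Rᶜ := fun i hi => by
    by_cases h : i ∈ R
    · exact Finset.mem_union_left _ (hvN (hv (Finset.mem_inter.2 ⟨h, hi⟩)))
    · exact Finset.mem_union_right _ (Finset.mem_compl.2 h)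
  have hRv : R ⊆ v ∪ R'ᶜ := fun i hi => by
    by_cases h : i ∈ R'
    · exact Finset.mem_union_left _ (hv (Finset.mem_inter.2 ⟨hi, h⟩))
    · exact Finset.mem_union_right _ (Finset.mem_compl.2 h)
  have hpN : p ∈ loc κ N := loc_mono (fun i hi => by
    simp only [Finset.mem_inter, Finset.mem_union, Finset.mem_compl] at hi
    tauto) (locSupp_mem_loc_inter (isStarProjection_star hP) hPR)
  have hbv : b ∈ loc κ v := loc_mono (fun i hi => by
    simp only [Finset.mem_inter, Finset.mem_union, Finset.mem_compl] at hi
    tauto) (locSupp_mem_loc_inter (isStarProjection_star hQ) hQR)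
  have hQp : Commute Q p := commute_locSupp (isStarProjection_star hP) (loc_mono hR'N hQR) hcomm.symm
  have hPb : Commute P b := commute_locSupp (isStarProjection_star hQ) (loc_mono hRv hPR) hcomm
  have hbp : Commute b p := commute_locSupp (isStarProjection_star hP)
    (loc_mono (hvN.trans Finset.subset_union_left) hbv) hPb.symm
  have hpproj : IsStarProjection p := isStarProjection_locSupp _ _
  have hbproj : IsStarProjection b := isStarProjection_locSupp _ _
  have hpb : p * b ∈ loc κ N := mul_mem hpN (loc_mono hvN hbv)
  have h1 : (1 - p * b) * nbhdMat ψ N = 0 := by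
    refine mul_locSupp_eq_zero (sub_mem (one_mem _) hpb) ?_
    rw [sub_mul, one_mul, ← hPQ, mul_assoc p, ← mul_assoc b, ← hPb.eq, mul_assoc P,
      locSupp_mul hQ, ← mul_assoc, locSupp_mul hP, sub_self]
  -- From (1 − Π_N) Q P = 0, replace P by its support p, move p past Q, then replace Q by its
  -- support b.
  have h2 : (1 - nbhdMat ψ N) * (p * b) = 0 := by
    have hX : 1 - nbhdMat ψ N ∈ loc κ N :=
      sub_mem (one_mem _) (locSupp_mem_loc_of_forall (isStarProjection_star hρ))
    have h3 : (1 - nbhdMat ψ N) * Q * p = 0 := by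
      refine mul_locSupp_eq_zero (mul_mem (loc_mono Finset.subset_union_left hX)
        (loc_mono hR'N hQR)) ?_
      rw [mul_assoc, ← hcomm.eq, hPQ, sub_mul, one_mul, locSupp_mul hρ, sub_self]
    rw [← mul_assoc]
    refine mul_locSupp_eq_zero (loc_mono (hN.trans hRv) (mul_mem hX hpN)) ?_
    rw [mul_assoc, ← hQp.eq, ← mul_assoc, h3]
  refine ⟨hQp, hbp, ?_⟩
  have h4 : star ((1 - nbhdMat ψ N) * (p * b)) = 0 := by rw [h2, star_zero]
  rw [star_mul, star_mul, isStarProjection_star hpproj, isStarProjection_star hbproj,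
    isStarProjection_star (isStarProjection_locSupp _ _).one_sub, hbp.eq, mul_sub, mul_one,
    sub_eq_zero] at h4
  rw [sub_mul, one_mul, sub_eq_zero] at h1
  exact h1.trans h4.symm

/-- Factorization gives Π_A = p b and Π_B = q a, with a, b the supports of P, Q on the overlap.
Tracing out more enlarges the support, so a p = p and b q = q; both products Π_A Π_B and Π_B Π_A
then reduce to p q = q p. -/
lemma commute_nbhdMat_of_cut (hψ : ‖ψ‖ = 1) (hP : IsStarProjection P) (hQ : IsStarProjection Q)
    (hPR : P ∈ loc κ R) (hQR : Q ∈ loc κ R') (hPQ : P * Q = pureState ψ) {A B : Finset ι}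
    (hA : A ⊆ R) (hB : B ⊆ R') (hAB : R ∩ R' ⊆ A ∩ B) :
    Commute (nbhdMat ψ A) (nbhdMat ψ B) := by
  have hρ := isStarProjection_pureState hψ
  have hcomm : Commute P Q := by
    have := congrArg star hPQ
    rw [star_mul, isStarProjection_star hP, isStarProjection_star hQ,
      isStarProjection_star hρ] at this
    exact hPQ.trans this.symm
  obtain ⟨hQp, hbp, h1⟩ := nbhdMat_eq_mul hψ hP hQ hPR hQR hPQ hcomm hAB hA Finset.inter_subset_left
  obtain ⟨hPq, haq, h2⟩ := nbhdMat_eq_mul hψ hQ hP hQR hPR (hcomm.eq ▸ hPQ) hcomm.symm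
    (Finset.inter_comm R R' ▸ hAB) hB Finset.inter_subset_right
  set p := locSupp (A ∪ Rᶜ) P with hp
  set b := locSupp (A ∩ B ∪ R'ᶜ) Q with hb
  set q := locSupp (B ∪ R'ᶜ) Q with hq
  set a := locSupp (A ∩ B ∪ Rᶜ) P with ha
  have absorb : ∀ {T T' : Finset ι} {X : Op κ}, IsStarProjection X → T ⊆ T' →
      locSupp T X * locSupp T' X = locSupp T' X := by
    intro T T' X hX hT
    have : (1 - locSupp T X) * locSupp T' X = 0 := by
      refine mul_locSupp_eq_zero (sub_mem (one_mem _)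
        (loc_mono hT (locSupp_mem_loc_of_forall (isStarProjection_star hX)))) ?_
      rw [sub_mul, one_mul, locSupp_mul hX, sub_self]
    rw [sub_mul, one_mul, sub_eq_zero] at this
    exact this.symm
  have hap : a * p = p := absorb hP (Finset.union_subset_union_left Finset.inter_subset_left)
  have hbq : b * q = q := absorb hQ (Finset.union_subset_union_left Finset.inter_subset_right)
  have hpq : Commute p q := by
    refine commute_locSupp (isStarProjection_star hQ) ?_ hQp.symm
    refine loc_mono (fun i hi => ?_) (locSupp_mem_loc_inter (isStarProjection_star hP) hPR)
    have h3 := @hAB i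
    simp only [Finset.mem_inter, Finset.mem_union, Finset.mem_compl] at hi h3 ⊢
    tauto
  have hpa : p * a = p := by
    have := congrArg star hap
    rwa [star_mul, isStarProjection_star (isStarProjection_locSupp _ _),
      isStarProjection_star (isStarProjection_locSupp _ _)] at this
  have hqb : q * b = q := by
    have := congrArg star hbq
    rwa [star_mul, isStarProjection_star (isStarProjection_locSupp _ _),
      isStarProjection_star (isStarProjection_locSupp _ _)] at this
  rw [Commute, SemiconjBy, h1, h2]
  calc p * b * (q * a) = p * (b * q) * a := by simp only [mul_assoc]
    _ = p * (a * q) := by rw [hbq, mul_assoc, haq.eq]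
    _ = p * q := by rw [← mul_assoc, hpa]
    _ = q * p := hpq.eq
    _ = q * (b * p) := by rw [← mul_assoc, hqb]
    _ = q * (a * p) * b := by rw [hap, hbp.eq, mul_assoc]
    _ = q * a * (p * b) := by simp only [mul_assoc]

end Cut

/-- The local support projectors of a robustly finite-time stabilizable state commute. -/
lemma commute_nbhdMat_of_isRFTS {𝒩 : NeighborhoodStructure ι}
    (h𝒩 : ∀ m j k, ¬ 𝒩.IsCyclePath m j k) {ψ : Space κ} (hψ : ‖ψ‖ = 1)
    (h : IsRFTS 𝒩 (pureState ψ)) {A B : Finset ι} (hA : A ∈ 𝒩.sets) (hB : B ∈ 𝒩.sets) :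
    Commute (nbhdMat ψ A) (nbhdMat ψ B) := by
  have hρ := isStarProjection_star (isStarProjection_pureState hψ)
  have hloc : ∀ S, nbhdMat ψ S ∈ loc κ S := fun S => locSupp_mem_loc_of_forall hρ
  by_cases hAB : A = B
  · rw [hAB]
  by_cases hd : Disjoint A B
  · exact commute_of_disjoint hd (hloc A) (hloc B)
  obtain ⟨i₀, hi₀⟩ := Finset.nonempty_iff_ne_empty.2 (mt Finset.disjoint_iff_inter_eq_empty.2 hd)
  obtain ⟨𝒜, h𝒜, hA𝒜, hB𝒜, hcut⟩ := NeighborhoodStructure.exists_cut h𝒩 hA hAB hi₀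
  have hmeet : ∀ 𝒮 : Finset (Finset ι), meet 𝒮 (nbhdMat ψ) ∈ loc κ (𝒮.biUnion id) := fun 𝒮 =>
    meet_mem_loc (fun i _ => isStarProjection_locSupp i _) fun S hS =>
      loc_mono (Finset.subset_biUnion_of_mem id hS) (hloc S)
  refine (commute_nbhdMat_of_cut hψ (isStarProjection_meet _ _) (isStarProjection_meet _ _)
    (hmeet (𝒩.sets \ 𝒜)) (hmeet 𝒜) (meet_mul_meet_of_isRFTS hψ h (by simp))
    (Finset.subset_biUnion_of_mem id (by simp [hB, hB𝒜])) (Finset.subset_biUnion_of_mem id hA𝒜)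
    ?_).symm
  intro i hi
  simp only [Finset.mem_inter, Finset.mem_biUnion, id, Finset.mem_sdiff] at hi
  obtain ⟨⟨S', ⟨hS', hnot⟩, hiS'⟩, S, hS, hiS⟩ := hi
  rw [Finset.inter_comm]
  exact hcut S hS S' hS' hnot (Finset.mem_inter.2 ⟨hiS, hiS'⟩)

end QuasiLocal

end

/-! ### Building blocks for local channels. -/

noncomputable section

namespace QuasiLocal

variable {ι : Type*} [Fintype ι] [DecidableEq ι]
  {κ : ι → Type*} [∀ i, Fintype (κ i)] [∀ i, DecidableEq (κ i)]

/-- The Hilbert–Schmidt inner product. -/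
abbrev hilbertSchmidtCore (n : Type*) [Fintype n] :
    InnerProductSpace.Core ℂ (Matrix n n ℂ) where
  inner X Y := (Xᴴ * Y).trace
  conj_inner_symm X Y := by
    rw [starRingEnd_apply, ← Matrix.trace_conjTranspose, Matrix.conjTranspose_mul,
      Matrix.conjTranspose_conjTranspose]
  re_inner_nonneg X :=
    (RCLike.nonneg_iff.1 (Matrix.posSemidef_conjTranspose_mul_self X).trace_nonneg).1
  add_left X Y Z := by simp [add_mul]
  smul_left X Y c := by simp
  definite X h := Matrix.trace_conjTranspose_mul_self_eq_zero_iff.1 h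

/-- Every space of matrices has an orthonormal basis for the Hilbert–Schmidt inner product. -/
lemma exists_trace_basis {n : Type*} [Fintype n] (V : Submodule ℂ (Matrix n n ℂ)) :
    ∃ (r : ℕ) (D : Fin r → Matrix n n ℂ), (∀ k, D k ∈ V) ∧
      ∀ Y ∈ V, Y = ∑ k, ((D k)ᴴ * Y).trace • D k := by
  let core := hilbertSchmidtCore n
  let _ : NormedAddCommGroup (Matrix n n ℂ) := core.toNormedAddCommGroup
  let _ : InnerProductSpace ℂ (Matrix n n ℂ) := InnerProductSpace.ofCore core.toCore
  let b := stdOrthonormalBasis ℂ V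
  refine ⟨_, fun k => (b k : Matrix n n ℂ), fun k => (b k).2, fun Y hY => ?_⟩
  have h := congrArg Subtype.val (b.sum_repr' ⟨Y, hY⟩)
  rw [Submodule.coe_sum] at h
  exact h.symm

/-- The sum `∑ₖ Dₖ† A Dₖ` over an orthonormal basis of a *-algebra commutes with the algebra. -/
lemma commute_sum_star_mul_mul {V : StarSubalgebra ℂ (Op κ)} {r : ℕ} {D : Fin r → Op κ}
    (hD : ∀ k, D k ∈ V) (hspan : ∀ Y ∈ V, Y = ∑ k, (star (D k) * Y).trace • D k)
    (A : Op κ) {X : Op κ} (hX : X ∈ V) : Commute (∑ k, star (D k) * A * D k) X := by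
  have h1 : ∀ k, D k * X = ∑ l, (star (D l) * (D k * X)).trace • D l :=
    fun k => hspan _ (mul_mem (hD k) hX)
  -- The coefficients are those of `h1` with k and l exchanged, so moving X from right to left only
  -- exchanges the order of a double sum.
  have h2 : ∀ l, X * star (D l) = ∑ k, (star (D l) * (D k * X)).trace • star (D k) := by
    intro l
    have h3 := congrArg star (hspan _ (mul_mem (hD l) (star_mem hX)))
    rw [star_mul, star_star, star_sum] at h3
    rw [h3]
    refine Finset.sum_congr rfl fun k _ => ?_
    rw [star_smul, Matrix.star_eq_conjTranspose (D l), ← Matrix.trace_conjTranspose,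
      ← Matrix.star_eq_conjTranspose, ← Matrix.star_eq_conjTranspose, star_mul, star_mul,
      star_star, star_star, mul_assoc, Matrix.trace_mul_comm, mul_assoc, Matrix.trace_mul_comm,
      mul_assoc]
  rw [Commute, SemiconjBy, Finset.sum_mul, Finset.mul_sum]
  calc ∑ k, star (D k) * A * D k * X
      = ∑ k, ∑ l, (star (D l) * (D k * X)).trace • (star (D k) * A * D l) := by
        refine Finset.sum_congr rfl fun k _ => ?_
        rw [mul_assoc, h1 k, Finset.mul_sum]
        refine Finset.sum_congr rfl fun l _ => ?_
        rw [mul_smul_comm, ← h1 k]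
    _ = ∑ l, ∑ k, (star (D l) * (D k * X)).trace • (star (D k) * A * D l) := Finset.sum_comm
    _ = ∑ l, X * (star (D l) * A * D l) := by
        refine Finset.sum_congr rfl fun l _ => ?_
        rw [← mul_assoc, ← mul_assoc, h2 l, Finset.sum_mul, Finset.sum_mul]
        exact Finset.sum_congr rfl fun k _ => by rw [smul_mul_assoc, smul_mul_assoc]

/-- A nonzero sum of squares that is a multiple of a projection is a positive multiple. -/
lemma pos_of_sum_star_mul_self {α : Type*} {t : Finset α} {Y : α → Op κ} {R : Op κ} {c : ℂ}
    (hR : IsStarProjection R) (h : ∑ i ∈ t, star (Y i) * Y i = c • R) {i : α} (hi : i ∈ t)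
    (hY : Y i ≠ 0) : 0 < c := by
  have hc : c ≠ 0 := by
    rintro rfl
    rw [zero_smul] at h
    exact hY (eq_zero_of_sum_star_mul_self h i hi)
  have hR0 : R ≠ 0 := by
    rintro rfl
    rw [smul_zero] at h
    exact hY (eq_zero_of_sum_star_mul_self h i hi)
  have h1 : 0 ≤ (∑ i ∈ t, star (Y i) * Y i).trace := by
    rw [Matrix.trace_sum]
    exact Finset.sum_nonneg fun i _ => (Matrix.posSemidef_conjTranspose_mul_self (Y i)).trace_nonneg
  have h2 : 0 ≤ R.trace := by
    have := (Matrix.posSemidef_conjTranspose_mul_self R).trace_nonneg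
    rwa [← Matrix.star_eq_conjTranspose, isStarProjection_star hR,
      isStarProjection_mul_self hR] at this
  have h3 : R.trace ≠ 0 := by
    intro h0
    rw [← isStarProjection_mul_self hR] at h0
    nth_rewrite 1 [← isStarProjection_star hR] at h0
    exact hR0 (Matrix.trace_conjTranspose_mul_self_eq_zero_iff.1 h0)
  rw [h, Matrix.trace_smul, smul_eq_mul] at h1
  refine lt_of_le_of_ne ?_ hc.symm
  have := mul_nonneg h1 (inv_nonneg.2 h2)
  rwa [mul_assoc, mul_inv_cancel₀ h3, mul_one] at this

lemma exists_star_mul_self_mul_eq_one {c : ℂ} (hc : 0 < c) : ∃ w : ℂ, star w * w * c = 1 := by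
  obtain ⟨hre, him⟩ := Complex.pos_iff.1 hc
  refine ⟨((Real.sqrt c.re)⁻¹ : ℝ), ?_⟩
  have hc' : c = (c.re : ℂ) := Complex.ext rfl (by simpa using him.symm)
  rw [Complex.star_def, Complex.conj_ofReal]
  nth_rewrite 3 [hc']
  rw [← Complex.ofReal_mul, ← Complex.ofReal_mul, ← mul_inv, Real.mul_self_sqrt hre.le,
    inv_mul_cancel₀ hre.ne', Complex.ofReal_one]

/-- There is a trace preserving family of Kraus operators with the property `p`. -/
def HasKraus (p : Op κ → Prop) : Prop :=
  ∃ (r : ℕ) (M : Fin r → Op κ), (∀ k, p (M k)) ∧ ∑ k, star (M k) * M k = 1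

lemma HasKraus.of_fintype {p : Op κ → Prop} {α : Type*} [Fintype α] (M : α → Op κ)
    (hM : ∀ k, p (M k)) (hsum : ∑ k, star (M k) * M k = 1) : HasKraus p :=
  ⟨Fintype.card α, fun k => M ((Fintype.equivFin α).symm k), fun _ => hM _,
    (Equiv.sum_comp (Fintype.equivFin α).symm fun k => star (M k) * M k).trans hsum⟩

lemma twirl_mem_loc_inter {S R : Finset ι} {X : Op κ} (hX : X ∈ loc κ R) :
    twirl S X ∈ loc κ (S ∩ R) := by
  refine mem_loc_inter (twirl_mem_loc S X) (mem_loc.2 fun i hi a b => ?_)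
  by_cases h : i ∈ S
  · exact (commute_twirl (siteUnit_mem_loc h a b) (mem_loc.1 hX i hi a b).symm).symm
  · exact mem_loc.1 (twirl_mem_loc S X) i h a b

lemma outerUnit_compl_mem_loc {v : Finset ι} (a b : OuterConfig κ vᶜ) :
    outerUnit vᶜ a b ∈ loc κ v :=
  outerUnit_mem_loc (fun i hi => by simpa using hi) a b

/-- The trace over `v` of a projection acting on `v` is a positive multiple of the identity. -/
lemma exists_twirl_eq_smul_one {v : Finset ι} {s : Op κ} (hs : IsStarProjection s) (hs0 : s ≠ 0)
    (hv : s ∈ loc κ v) : ∃ c : ℂ, 0 < c ∧ twirl vᶜ s = c • (1 : Op κ) := by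
  have h1 : twirl vᶜ s ∈ loc κ ∅ := by
    have := twirl_mem_loc_inter (S := vᶜ) hv
    rwa [Finset.inter_comm, Finset.inter_compl] at this
  obtain ⟨c, hc⟩ := exists_eq_smul_one_of_mem_loc_empty h1
  refine ⟨c, ?_, hc⟩
  have hsum : ∑ ab : OuterConfig κ vᶜ × OuterConfig κ vᶜ,
      star (s * outerUnit vᶜ ab.2 ab.1) * (s * outerUnit vᶜ ab.2 ab.1) = c • (1 : Op κ) := by
    rw [← hc, twirl_eq_sum, ← Finset.univ_product_univ, Finset.sum_product]
    refine Finset.sum_congr rfl fun a _ => Finset.sum_congr rfl fun b _ => ?_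
    rw [star_mul, isStarProjection_star hs, star_outerUnit, mul_assoc, ← mul_assoc s,
      isStarProjection_mul_self hs, mul_assoc]
  by_contra hpos
  apply hs0
  rw [← mul_one s, ← sum_outerUnit vᶜ, Finset.mul_sum]
  refine Finset.sum_eq_zero fun a _ => ?_
  by_contra hne
  exact hpos (pos_of_sum_star_mul_self (IsStarProjection.one _) hsum (Finset.mem_univ (a, a)) hne)

/-- States can be moved into the range of a local projection by a local channel. -/
lemma hasKraus_of_projection {v : Finset ι} {s : Op κ} (hs : IsStarProjection s) (hs0 : s ≠ 0)
    (hv : s ∈ loc κ v) : HasKraus fun L : Op κ => L ∈ loc κ v ∧ s * L = L ∧ (L = s ∨ L * s = 0) := by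
  obtain ⟨c, hc, hcs⟩ := exists_twirl_eq_smul_one hs hs0 hv
  obtain ⟨w, hw⟩ := exists_star_mul_self_mul_eq_one hc
  -- One operator is s itself; the others carry the complement of its range into it. Their squares
  -- add up to |w|² (1 − s) Tr_v(s) (1 − s), which the choice of w makes equal to 1 − s.
  refine HasKraus.of_fintype (α := Option (OuterConfig κ vᶜ × OuterConfig κ vᶜ))
    (fun o => o.elim s fun ab => w • (s * outerUnit vᶜ ab.2 ab.1 * (1 - s))) ?_ ?_
  · rintro (_ | ⟨a, b⟩)
    · exact ⟨hv, isStarProjection_mul_self hs, Or.inl rfl⟩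
    · refine ⟨SMulMemClass.smul_mem w (mul_mem (mul_mem hv (outerUnit_compl_mem_loc b a))
        (sub_mem (one_mem _) hv)), ?_, Or.inr ?_⟩
      · simp only [Option.elim, mul_smul_comm, ← mul_assoc, isStarProjection_mul_self hs]
      · simp only [Option.elim, smul_mul_assoc, mul_assoc, hs.one_sub_mul_self, mul_zero, smul_zero]
  · rw [Fintype.sum_option]
    simp only [Option.elim]
    have h1 : ∑ ab : OuterConfig κ vᶜ × OuterConfig κ vᶜ,
        star (w • (s * outerUnit vᶜ ab.2 ab.1 * (1 - s))) *
          (w • (s * outerUnit vᶜ ab.2 ab.1 * (1 - s))) =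
        (star w * w) • ((1 - s) * twirl vᶜ s * (1 - s)) := by
      rw [twirl_eq_sum, Finset.mul_sum, Finset.sum_mul, Finset.smul_sum, ← Finset.univ_product_univ,
        Finset.sum_product]
      refine Finset.sum_congr rfl fun a _ => ?_
      rw [Finset.mul_sum, Finset.sum_mul, Finset.smul_sum]
      refine Finset.sum_congr rfl fun b _ => ?_
      simp only [star_smul, star_mul, isStarProjection_star hs, isStarProjection_star hs.one_sub,
        star_outerUnit, smul_mul_assoc, mul_smul_comm, smul_smul, mul_assoc]
      rw [← mul_assoc s s, isStarProjection_mul_self hs, mul_comm w]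
    rw [h1, hcs, mul_smul_comm, smul_mul_assoc, smul_smul, mul_one,
      isStarProjection_mul_self hs.one_sub, hw, one_smul, isStarProjection_star hs,
      isStarProjection_mul_self hs]
    abel

end QuasiLocal

end

/-! ### Sufficiency: a channel on one neighborhood that respects the others. -/

noncomputable section

namespace QuasiLocal

variable {ι : Type*} [Fintype ι] [DecidableEq ι]
  {κ : ι → Type*} [∀ i, Fintype (κ i)] [∀ i, DecidableEq (κ i)]

/-- The operators on the neighborhood `J` that commute with the support projectors of the
neighborhoods in `t`. -/
def symmetryAlgebra (ψ : Space κ) (J : Finset ι) (t : Finset (Finset ι)) :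
    StarSubalgebra ℂ (Op κ) :=
  loc κ J ⊓ StarSubalgebra.centralizer ℂ (nbhdMat ψ '' t)

section Support

variable {ψ : Space κ} (hψ : ‖ψ‖ = 1)
include hψ

lemma nbhdMat_mem_loc (S : Finset ι) : nbhdMat ψ S ∈ loc κ S :=
  locSupp_mem_loc_of_forall (isStarProjection_star (isStarProjection_pureState hψ))

lemma mem_symmetryAlgebra {J : Finset ι} {t : Finset (Finset ι)} {X : Op κ} :
    X ∈ symmetryAlgebra ψ J t ↔ X ∈ loc κ J ∧ ∀ k ∈ t, Commute (nbhdMat ψ k) X := by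
  rw [symmetryAlgebra, StarSubalgebra.mem_inf, StarSubalgebra.mem_centralizer_iff]
  refine and_congr_right fun _ => ?_
  rw [Set.forall_mem_image]
  refine forall₂_congr fun k _ => ?_
  rw [isStarProjection_star (isStarProjection_locSupp k (pureState ψ)), and_self_iff]
  rfl

/-- The operator 1 − Π_S is also local on T and kills ψ. -/
lemma nbhdMat_mul_of_subset {S T : Finset ι} (h : S ⊆ T) :
    nbhdMat ψ S * nbhdMat ψ T = nbhdMat ψ T := by
  have h1 : (1 - nbhdMat ψ S) * nbhdMat ψ T = 0 := by
    refine mul_locSupp_eq_zero (sub_mem (one_mem _) (loc_mono h (nbhdMat_mem_loc hψ S))) ?_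
    rw [sub_mul, one_mul, locSupp_mul (isStarProjection_pureState hψ), sub_self]
  rw [sub_mul, one_mul, sub_eq_zero] at h1
  exact h1.symm

lemma commute_nbhdMat_of_subset {S T : Finset ι} (h : S ⊆ T) :
    Commute (nbhdMat ψ S) (nbhdMat ψ T) := by
  have h1 := nbhdMat_mul_of_subset hψ h
  have h2 := congrArg star h1
  rw [star_mul, isStarProjection_star (isStarProjection_locSupp _ _),
    isStarProjection_star (isStarProjection_locSupp _ _)] at h2
  exact h1.trans h2.symm

lemma nbhdMat_ne_zero (S : Finset ι) : nbhdMat ψ S ≠ 0 := fun h => by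
  have := locSupp_mul (S := S) (isStarProjection_pureState hψ)
  rw [show locSupp S (pureState ψ) = 0 from h, zero_mul] at this
  exact pureState_ne_zero hψ this.symm

end Support

section Neighborhood

variable {ψ : Space κ} (hψ : ‖ψ‖ = 1) {J : Finset ι} {t : Finset (Finset ι)}
  (hv : ∀ i ∈ t, ∀ k ∈ t, i ∩ J = k ∩ J ∨ Disjoint (i ∩ J) k)
include hψ hv

/-- There are local Kraus operators that lead to the supports of the reduced states on the overlaps
of `J` with its neighbors, and preserve the supports on the neighbors. -/
lemma hasKraus_overlap {t' : Finset (Finset ι)} (ht' : t' ⊆ t) :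
    HasKraus fun L : Op κ => L ∈ loc κ J ∧
      (∀ k ∈ t, nbhdMat ψ k * L * nbhdMat ψ k = L * nbhdMat ψ k) ∧
      (∀ k ∈ t, nbhdMat ψ (k ∩ J) * L * nbhdMat ψ (k ∩ J) = L * nbhdMat ψ (k ∩ J)) ∧
      ∀ i ∈ t', nbhdMat ψ (i ∩ J) * L = L := by
  induction t' using Finset.induction_on with
  | empty =>
    refine HasKraus.of_fintype (α := Unit) (fun _ => 1) (fun _ => ⟨one_mem _, ?_, ?_, by simp⟩)
      (by simp)
    · intro k _
      rw [mul_one, one_mul, isStarProjection_mul_self (isStarProjection_locSupp _ _)]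
    · intro k _
      rw [mul_one, one_mul, isStarProjection_mul_self (isStarProjection_locSupp _ _)]
  | insert i t' _ ih =>
    have hit : i ∈ t := ht' (Finset.mem_insert_self i t')
    obtain ⟨r, L, hL, hLsum⟩ := ih fun k hk => ht' (Finset.mem_insert_of_mem hk)
    obtain ⟨r', L', hL', hLsum'⟩ := hasKraus_of_projection (isStarProjection_locSupp _ _)
      (nbhdMat_ne_zero hψ (i ∩ J)) (nbhdMat_mem_loc hψ (i ∩ J))
    -- If T contains the overlap, the range of Π_T lies in that of the support on the overlap, which
    -- each Kraus operator fixes or annihilates. If T is disjoint from it, the operators commute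
    -- with Π_T.
    have key : ∀ (a : Fin r') (T : Finset ι), i ∩ J ⊆ T ∨ Disjoint (i ∩ J) T →
        nbhdMat ψ T * L' a * nbhdMat ψ T = L' a * nbhdMat ψ T := by
      rintro a T (h | h)
      · rcases (hL' a).2.2 with h1 | h1
        · rw [h1, ← (commute_nbhdMat_of_subset hψ h).eq, mul_assoc,
            isStarProjection_mul_self (isStarProjection_locSupp _ _)]
        · have : L' a * nbhdMat ψ T = 0 := by
            rw [← nbhdMat_mul_of_subset hψ h, ← mul_assoc, h1, zero_mul]
          rw [mul_assoc, this, mul_zero]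
      · rw [← (commute_of_disjoint h (hL' a).1 (nbhdMat_mem_loc hψ T)).eq, mul_assoc,
          isStarProjection_mul_self (isStarProjection_locSupp _ _)]
    have hk1 : ∀ k ∈ t, i ∩ J ⊆ k ∨ Disjoint (i ∩ J) k := fun k hk =>
      (hv i hit k hk).imp (fun h => h.subset.trans Finset.inter_subset_left) id
    have hk2 : ∀ k ∈ t, i ∩ J ⊆ k ∩ J ∨ Disjoint (i ∩ J) (k ∩ J) := fun k hk =>
      (hv i hit k hk).imp (fun h => h.subset)
        (fun h => h.mono_right Finset.inter_subset_left)
    have comp : ∀ {Q A B : Op κ}, Q * A * Q = A * Q → Q * B * Q = B * Q →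
        Q * (A * B) * Q = A * B * Q := by
      intro Q A B hA hB
      calc Q * (A * B) * Q = Q * A * (B * Q) := by simp only [mul_assoc]
        _ = Q * A * Q * B * Q := by rw [← hB]; simp only [mul_assoc]
        _ = A * (Q * B * Q) := by rw [hA]; simp only [mul_assoc]
        _ = A * B * Q := by rw [hB, mul_assoc]
    refine HasKraus.of_fintype (α := Fin r × Fin r') (fun a => L' a.2 * L a.1) ?_ ?_
    · rintro ⟨a, b⟩
      refine ⟨mul_mem (loc_mono Finset.inter_subset_right (hL' b).1) (hL a).1, ?_, ?_, ?_⟩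
      · exact fun k hk => comp (key b k (hk1 k hk)) ((hL a).2.1 k hk)
      · exact fun k hk => comp (key b _ (hk2 k hk)) ((hL a).2.2.1 k hk)
      · intro k hk
        rcases Finset.mem_insert.1 hk with rfl | hk'
        · rw [← mul_assoc, (hL' b).2.1]
        · have h1 := (hL a).2.2.2 k hk'
          have h2 := key b _ (hk2 k (ht' hk))
          calc nbhdMat ψ (k ∩ J) * (L' b * L a)
              = nbhdMat ψ (k ∩ J) * L' b * nbhdMat ψ (k ∩ J) * L a := by
                conv_lhs => rw [← h1]
                simp only [mul_assoc]
            _ = L' b * L a := by rw [h2, mul_assoc, h1]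
    · rw [← Finset.univ_product_univ, Finset.sum_product, ← hLsum]
      refine Finset.sum_congr rfl fun a _ => ?_
      have : ∀ b, star (L' b * L a) * (L' b * L a) = star (L a) * (star (L' b) * L' b) * L a :=
        fun b => by simp only [star_mul, mul_assoc]
      simp only [this]
      rw [← Finset.sum_mul, ← Finset.mul_sum, hLsum', mul_one]

variable (hJ : nbhdMat ψ J ∈ symmetryAlgebra ψ J t)
  (hρ : ∀ X : Op κ, (∀ k ∈ t, Commute X (nbhdMat ψ k)) → Commute X (nbhdMat ψ J) →
    Commute X (pureState ψ))

/-- Tracing out J \ i preserves commutation with a Π_k having the same overlap with J, because that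
k avoids J \ i. Any other k misses the overlap altogether. -/
lemma slice_mem_symmetryAlgebra {i : Finset ι} (hi : i ∈ t) {X Y : Op κ}
    (hX : X ∈ symmetryAlgebra ψ J t) (hY : Y ∈ loc κ (i ∩ J ∪ Jᶜ)ᶜ) :
    twirl (i ∩ J ∪ Jᶜ) (X * Y) ∈ loc κ (i ∩ J) ∧
      twirl (i ∩ J ∪ Jᶜ) (X * Y) ∈ symmetryAlgebra ψ J t := by
  rw [mem_symmetryAlgebra hψ] at hX
  have hYJ : Y ∈ loc κ J := loc_mono (fun x hx => by
    simp only [Finset.mem_compl, Finset.mem_union] at hx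
    tauto) hY
  have h1 : twirl (i ∩ J ∪ Jᶜ) (X * Y) ∈ loc κ (i ∩ J) :=
    loc_mono (fun x hx => by
      simp only [Finset.mem_compl, Finset.mem_union, Finset.mem_inter] at hx ⊢
      tauto) (twirl_mem_loc_inter (mul_mem hX.1 hYJ))
  refine ⟨h1, (mem_symmetryAlgebra hψ).2 ⟨loc_mono Finset.inter_subset_right h1, fun k hk => ?_⟩⟩
  rcases hv i hi k hk with h | h
  · have hk' : k ⊆ i ∩ J ∪ Jᶜ := fun x hx => by
      by_cases hxJ : x ∈ J
      · exact Finset.mem_union_left _ (h ▸ Finset.mem_inter.2 ⟨hx, hxJ⟩)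
      · exact Finset.mem_union_right _ (Finset.mem_compl.2 hxJ)
    have hk'' := loc_mono hk' (nbhdMat_mem_loc hψ k)
    exact (commute_twirl hk'' ((hX.2 k hk).symm.mul_left
      (commute_of_disjoint disjoint_compl_left hY hk''))).symm
  · exact (commute_of_disjoint h h1 (nbhdMat_mem_loc hψ k)).symm

include hJ hρ

/-- The center of the symmetry algebra acts trivially on the support of the reduced state of an
overlap. -/
lemma commute_corner {Z : Op κ} (hZ : Z ∈ symmetryAlgebra ψ J t)
    (hcenter : ∀ X ∈ symmetryAlgebra ψ J t, Commute Z X) {i : Finset ι} (hi : i ∈ t) {Q : Op κ}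
    (hQ : Q ∈ loc κ (i ∩ J)) :
    Commute Z (nbhdMat ψ (i ∩ J) * Q * nbhdMat ψ (i ∩ J)) := by
  have hpr := isStarProjection_pureState hψ
  set S := i ∩ J ∪ Jᶜ with hS
  set s := nbhdMat ψ (i ∩ J) with hs
  have hsl : s ∈ loc κ (i ∩ J) := nbhdMat_mem_loc hψ _
  have hSc : ∀ {X Y : Op κ}, X ∈ loc κ (i ∩ J) → Y ∈ loc κ Sᶜ → Commute X Y := fun hX hY =>
    commute_of_disjoint (Finset.disjoint_left.2 fun x hx hx' => by
      simp only [hS, Finset.mem_compl, Finset.mem_union] at hx'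
      tauto) hX hY
  have hlS : loc κ (i ∩ J) ≤ loc κ S := loc_mono Finset.subset_union_left
  have slice : ∀ Y ∈ loc κ Sᶜ, ∃ c : ℂ, twirl S (Z * Y) * s = c • s ∧
      Commute s (twirl S (Z * Y)) := by
    intro Y hY
    obtain ⟨hC, hC'⟩ := slice_mem_symmetryAlgebra hψ hv hi hZ hY
    rw [← hS] at hC hC'
    set C := twirl S (Z * Y) with hCdef
    have h1 : ∀ X ∈ loc κ (i ∩ J), X ∈ symmetryAlgebra ψ J t → Commute C X := fun X hX hX' =>
      commute_twirl (hlS hX) ((hcenter X hX').mul_left (hSc hX hY).symm)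
    -- C commutes with the slices of Π_J, which again belong to the symmetry algebra, and slices
    -- determine the operator. So C commutes with every projector, hence with ρ, and is scalar on
    -- the support of the overlap.
    have h2 : Commute C (nbhdMat ψ J) := by
      rw [Commute, SemiconjBy, ← sub_eq_zero]
      refine eq_zero_of_twirl_mul (S := S) fun Y' hY' => ?_
      obtain ⟨hX, hX'⟩ := slice_mem_symmetryAlgebra hψ hv hi hJ hY'
      have h3 : (C * nbhdMat ψ J - nbhdMat ψ J * C) * Y' =
          C * (nbhdMat ψ J * Y') - nbhdMat ψ J * Y' * C := by
        rw [sub_mul, mul_assoc, mul_assoc, mul_assoc, (hSc hC hY').eq]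
      rw [h3, twirl_sub, twirl_mul_left _ (hlS hC), twirl_mul_right _ (hlS hC), sub_eq_zero]
      exact (h1 _ hX hX').eq
    have h4 : Commute C (pureState ψ) :=
      hρ C (fun k hk => (((mem_symmetryAlgebra hψ).1 hC').2 k hk).symm) h2
    obtain ⟨c, -, hc⟩ := exists_mul_locSupp_eq_smul hψ hC (by
      rw [mul_assoc, h4.eq, ← mul_assoc, sub_mul, one_mul, isStarProjection_mul_self hpr, sub_self,
        zero_mul])
    exact ⟨c, hc, (commute_locSupp (isStarProjection_star hpr) hC h4).symm⟩
  have hQ' : s * Q * s ∈ loc κ (i ∩ J) := mul_mem (mul_mem hsl hQ) hsl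
  rw [Commute, SemiconjBy, ← sub_eq_zero]
  refine eq_zero_of_twirl_mul (S := S) fun Y hY => ?_
  have h3 : (Z * (s * Q * s) - s * Q * s * Z) * Y = Z * Y * (s * Q * s) - s * Q * s * (Z * Y) := by
    rw [sub_mul, mul_assoc, (hSc hQ' hY).eq, mul_assoc (s * Q * s), mul_assoc Z]
  obtain ⟨c, hc, hsC⟩ := slice Y hY
  rw [h3, twirl_sub, twirl_mul_left _ (hlS hQ'), twirl_mul_right _ (hlS hQ'), sub_eq_zero]
  calc twirl S (Z * Y) * (s * Q * s) = twirl S (Z * Y) * s * Q * s := by simp only [mul_assoc]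
    _ = s * Q * (c • s) := by rw [hc]; simp only [smul_mul_assoc, mul_smul_comm]
    _ = s * Q * s * twirl S (Z * Y) := by rw [← hc, ← hsC.eq, mul_assoc (s * Q)]

/-- On the support of an overlap Z acts trivially, so there it can be replaced by a normalized
partial trace over that overlap. The overlaps are removed one by one; the commutation clauses are
what the induction and the final step need. -/
lemma exists_reduction {Z : Op κ} (hZ : Z ∈ symmetryAlgebra ψ J t)
    (hcenter : ∀ X ∈ symmetryAlgebra ψ J t, Commute Z X) {t' : Finset (Finset ι)} (ht' : t' ⊆ t) :
    ∃ Z' ∈ loc κ (J \ t'.biUnion (· ∩ J)),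
      (∀ k ∈ t, ∀ Q ∈ loc κ (k ∩ J),
        Commute Z' (nbhdMat ψ (k ∩ J) * Q * nbhdMat ψ (k ∩ J))) ∧
      (∀ W ∈ loc κ (J \ t.biUnion (· ∩ J)), Commute Z' W) ∧
      Z * meet t (fun i => nbhdMat ψ (i ∩ J)) = Z' * meet t (fun i => nbhdMat ψ (i ∩ J)) := by
  have hproj : ∀ i ∈ t, IsStarProjection (nbhdMat ψ (i ∩ J)) :=
    fun i _ => isStarProjection_locSupp _ _
  induction t' using Finset.induction_on with
  | empty =>
    refine ⟨Z, by simpa using ((mem_symmetryAlgebra hψ).1 hZ).1,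
      fun k hk Q hQ => commute_corner hψ hv hJ hρ hZ hcenter hk hQ, fun W hW => ?_, rfl⟩
    refine hcenter W ((mem_symmetryAlgebra hψ).2 ⟨loc_mono Finset.sdiff_subset hW, fun k hk => ?_⟩)
    refine (commute_of_disjoint (Finset.disjoint_left.2 fun x hx hxk => ?_) hW
      (nbhdMat_mem_loc hψ k)).symm
    simp only [Finset.mem_sdiff, Finset.mem_biUnion, Finset.mem_inter] at hx
    exact hx.2 ⟨k, hk, hxk, hx.1⟩
  | insert i t' _ ih =>
    have hit : i ∈ t := ht' (Finset.mem_insert_self i t')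
    obtain ⟨Z', hZ'loc, hZ'corner, hZ'W, hZ'⟩ := ih fun k hk => ht' (Finset.mem_insert_of_mem hk)
    set s := nbhdMat ψ (i ∩ J) with hs
    have hsp : IsStarProjection s := isStarProjection_locSupp _ _
    have hsl : s ∈ loc κ (i ∩ J) := nbhdMat_mem_loc hψ _
    obtain ⟨c, hc, hcs⟩ := exists_twirl_eq_smul_one hsp (nbhdMat_ne_zero hψ _) hsl
    have hcorner : ∀ Q ∈ loc κ (i ∩ J), Commute Z' (s * Q * s) := hZ'corner i hit
    have hZs : Commute Z' s := by
      have := hcorner 1 (one_mem _)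
      rwa [mul_one, isStarProjection_mul_self hsp] at this
    have hcompl : ∀ {X Y : Op κ}, X ∈ loc κ (i ∩ J) → Y ∈ loc κ (i ∩ J)ᶜ → Commute X Y :=
      fun hX hY => commute_of_disjoint disjoint_compl_right hX hY
    -- Commuting with the full corner of s makes Z' s a product of s with an operator off the
    -- overlap; the constant c is the trace of s over the overlap.
    have hred : twirl (i ∩ J)ᶜ (Z' * s) * s = c • (Z' * s) := by
      calc twirl (i ∩ J)ᶜ (Z' * s) * s = s * twirl (i ∩ J)ᶜ (Z' * s) * s := by
            rw [(hcompl hsl (twirl_mem_loc _ (Z' * s))).eq, mul_assoc,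
              isStarProjection_mul_self hsp]
        _ = Z' * (s * twirl (i ∩ J)ᶜ s * s) := by
            simp only [twirl_eq_sum, Finset.mul_sum, Finset.sum_mul]
            refine Finset.sum_congr rfl fun a _ => Finset.sum_congr rfl fun b _ => ?_
            have h1 := (hcorner _ (outerUnit_compl_mem_loc a b)).eq
            calc s * (outerUnit (i ∩ J)ᶜ a b * (Z' * s) * outerUnit (i ∩ J)ᶜ b a) * s
                = s * outerUnit (i ∩ J)ᶜ a b * s * Z' * outerUnit (i ∩ J)ᶜ b a * s := by
                  rw [hZs.eq]; simp only [mul_assoc]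
              _ = _ := by rw [← h1]; simp only [mul_assoc]
        _ = c • (Z' * s) := by
            rw [hcs, mul_smul_comm, smul_mul_assoc, mul_one, isStarProjection_mul_self hsp,
              mul_smul_comm]
    refine ⟨c⁻¹ • twirl (i ∩ J)ᶜ (Z' * s), SMulMemClass.smul_mem _ ?_, ?_, ?_, ?_⟩
    · refine loc_mono (fun x hx => ?_) (twirl_mem_loc_inter (S := (i ∩ J)ᶜ)
        (mul_mem (loc_mono Finset.subset_union_left hZ'loc)
          (loc_mono (Finset.subset_union_right (s₁ := J \ t'.biUnion (· ∩ J))) hsl)))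
      simp only [Finset.mem_inter, Finset.mem_compl, Finset.mem_union, Finset.mem_sdiff,
        Finset.biUnion_insert] at hx ⊢
      tauto
    · intro k hk Q hQ
      have hQ' : nbhdMat ψ (k ∩ J) * Q * nbhdMat ψ (k ∩ J) ∈ loc κ (k ∩ J) :=
        mul_mem (mul_mem (nbhdMat_mem_loc hψ _) hQ) (nbhdMat_mem_loc hψ _)
      refine Commute.smul_left ?_ _
      rcases hv i hit k hk with h | h
      · rw [← h] at hQ' ⊢
        exact (hcompl hQ' (twirl_mem_loc _ _)).symm
      · have hd : Disjoint (i ∩ J) (k ∩ J) := h.mono_right Finset.inter_subset_left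
        refine commute_twirl (loc_mono (Finset.subset_compl_iff_disjoint_left.2 hd) hQ') ?_
        exact (hZ'corner k hk Q hQ).mul_left (commute_of_disjoint hd hsl hQ')
    · intro W hW
      have hd : Disjoint (i ∩ J) (J \ t.biUnion (· ∩ J)) := Finset.disjoint_left.2 fun x hx hx' =>
        (Finset.mem_sdiff.1 hx').2 (Finset.mem_biUnion.2 ⟨i, hit, hx⟩)
      refine Commute.smul_left ?_ _
      refine commute_twirl (loc_mono (Finset.subset_compl_iff_disjoint_left.2 hd) hW) ?_
      exact (hZ'W W hW).mul_left (commute_of_disjoint hd hsl hW)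
    · have hm : s * meet t (fun i => nbhdMat ψ (i ∩ J)) = meet t (fun i => nbhdMat ψ (i ∩ J)) :=
        mul_meet hproj hit
      rw [hZ', ← hm, ← mul_assoc, ← mul_assoc, smul_mul_assoc, hred, smul_smul,
        inv_mul_cancel₀ hc.ne', one_smul]

/-- With all overlaps removed, what remains of Z acts on the part of J met by no neighbor and
commutes with every operator there, so it is a scalar. -/
lemma exists_mul_meet_eq_smul {Z : Op κ} (hZ : Z ∈ symmetryAlgebra ψ J t)
    (hcenter : ∀ X ∈ symmetryAlgebra ψ J t, Commute Z X) :
    ∃ c : ℂ, Z * meet t (fun i => nbhdMat ψ (i ∩ J)) =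
      c • meet t (fun i => nbhdMat ψ (i ∩ J)) := by
  obtain ⟨Z', hloc, -, hW, hZ'⟩ := exists_reduction hψ hv hJ hρ hZ hcenter (subset_refl t)
  have h0 : Z' ∈ loc κ ∅ := mem_loc.2 fun x _ a b => by
    by_cases hx : x ∈ J \ t.biUnion (· ∩ J)
    · exact (hW _ (siteUnit_mem_loc hx a b)).symm
    · exact mem_loc.1 hloc x hx a b
  obtain ⟨c, rfl⟩ := exists_eq_smul_one_of_mem_loc_empty h0
  exact ⟨c, by rw [hZ', smul_mul_assoc, one_mul]⟩

/-- There are Kraus operators on `J` that lead to the support of the reduced state on `J`, and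
preserve the supports on the other neighborhoods. -/
lemma hasKraus_nbhd :
    HasKraus fun M : Op κ => M ∈ loc κ J ∧ nbhdMat ψ J * M = M ∧
      ∀ k ∈ t, nbhdMat ψ k * M * nbhdMat ψ k = M * nbhdMat ψ k := by
  have hpr := isStarProjection_pureState hψ
  set V := symmetryAlgebra ψ J t with hV
  set s := meet t (fun i => nbhdMat ψ (i ∩ J)) with hs
  have hproj : ∀ i ∈ t, IsStarProjection (nbhdMat ψ (i ∩ J)) :=
    fun i _ => isStarProjection_locSupp _ _
  have hpJ : IsStarProjection (nbhdMat ψ J) := isStarProjection_locSupp _ _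
  obtain ⟨r, D, hD, hspan⟩ := exists_trace_basis V.toSubmodule
  replace hD : ∀ k, D k ∈ V := hD
  replace hspan : ∀ Y ∈ V, Y = ∑ k, (star (D k) * Y).trace • D k := hspan
  set Z := ∑ k, star (D k) * nbhdMat ψ J * D k with hZdef
  have hZ : Z ∈ V := sum_mem fun k _ => mul_mem (mul_mem (star_mem (hD k)) hJ) (hD k)
  obtain ⟨c, hc⟩ := exists_mul_meet_eq_smul hψ hv hJ hρ hZ
    fun X hX => commute_sum_star_mul_mul hD hspan _ hX
  have hsρ : s * pureState ψ = pureState ψ := meet_mul hproj fun i _ => locSupp_mul hpr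
  have hZρ : ∑ k, star (nbhdMat ψ J * D k * pureState ψ) * (nbhdMat ψ J * D k * pureState ψ) =
      c • pureState ψ := by
    have h1 : pureState ψ * Z * pureState ψ = c • pureState ψ := by
      rw [mul_assoc]
      nth_rewrite 2 [← hsρ]
      rw [← mul_assoc Z, hc, smul_mul_assoc, hsρ, mul_smul_comm, isStarProjection_mul_self hpr]
    rw [← h1, hZdef, Finset.mul_sum, Finset.sum_mul]
    refine Finset.sum_congr rfl fun k _ => ?_
    simp only [star_mul, isStarProjection_star hpr, isStarProjection_star hpJ, mul_assoc]
    rw [← mul_assoc (nbhdMat ψ J) (nbhdMat ψ J), isStarProjection_mul_self hpJ]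
  -- Otherwise Π_J D_k kills ψ for all k; but the D_k span the identity, and Π_J fixes ψ.
  have hcpos : 0 < c := by
    by_contra hneg
    apply pureState_ne_zero hψ
    have h1 : ∀ k, nbhdMat ψ J * D k * pureState ψ = 0 := fun k => by
      by_contra hne
      exact hneg (pos_of_sum_star_mul_self hpr hZρ (Finset.mem_univ k) hne)
    calc pureState ψ = nbhdMat ψ J * 1 * pureState ψ := by rw [mul_one, locSupp_mul hpr]
      _ = 0 := by
        rw [hspan 1 (one_mem _), Finset.mul_sum, Finset.sum_mul]
        exact Finset.sum_eq_zero fun k _ => by rw [mul_smul_comm, smul_mul_assoc, h1, smul_zero]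
  obtain ⟨w, hw⟩ := exists_star_mul_self_mul_eq_one hcpos
  obtain ⟨r', L, hL, hLsum⟩ := hasKraus_overlap hψ hv (subset_refl t)
  -- First L moves states to the common range of the overlap supports, where Z = c; then w with |w|²
  -- c = 1 normalizes the operators Π_J D_b.
  refine HasKraus.of_fintype (α := Fin r' × Fin r)
    (fun a => w • (nbhdMat ψ J * D a.2 * L a.1)) ?_ ?_
  · rintro ⟨a, b⟩
    have hDb := (mem_symmetryAlgebra hψ).1 (hD b)
    have hJ' := (mem_symmetryAlgebra hψ).1 hJ
    refine ⟨SMulMemClass.smul_mem w (mul_mem (mul_mem hJ'.1 hDb.1) (hL a).1), ?_, fun k hk => ?_⟩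
    · rw [mul_smul_comm, ← mul_assoc, ← mul_assoc, isStarProjection_mul_self hpJ]
    · have h1 := (hL a).2.1 k hk
      rw [mul_smul_comm, smul_mul_assoc, smul_mul_assoc, ← mul_assoc,
        ((hJ'.2 k hk).mul_right (hDb.2 k hk)).eq, mul_assoc _ _ (L a), mul_assoc, h1]
      simp only [mul_assoc]
  · have hZL : ∀ a, Z * L a = c • L a := fun a => by
      have h1 : s * L a = L a := meet_mul hproj (hL a).2.2.2
      rw [← h1, ← mul_assoc, hc, smul_mul_assoc]
    rw [← Finset.univ_product_univ, Finset.sum_product, ← hLsum]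
    refine Finset.sum_congr rfl fun a _ => ?_
    calc ∑ b, star (w • (nbhdMat ψ J * D b * L a)) * (w • (nbhdMat ψ J * D b * L a))
        = (star w * w) • (star (L a) * (Z * L a)) := by
          rw [hZdef, Finset.sum_mul, Finset.mul_sum, Finset.smul_sum]
          refine Finset.sum_congr rfl fun b _ => ?_
          simp only [star_smul, star_mul, isStarProjection_star hpJ, smul_mul_assoc, mul_smul_comm,
            smul_smul, mul_assoc]
          rw [← mul_assoc (nbhdMat ψ J) (nbhdMat ψ J), isStarProjection_mul_self hpJ, mul_comm w]
      _ = star (L a) * L a := by rw [hZL, mul_smul_comm, smul_smul, hw, one_smul]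

end Neighborhood

end QuasiLocal

end

/-! ### Assembling the channels under matching overlap. -/

namespace NeighborhoodStructure

variable {ι : Type*} [Fintype ι] [DecidableEq ι]

/-- With matching overlap, the overlaps of a neighborhood with the other ones are equal or
disjoint. -/
lemma MatchingOverlap.inter_eq_or_disjoint {𝒩 : NeighborhoodStructure ι}
    (h : 𝒩.MatchingOverlap) {A B J : Finset ι} (hA : A ∈ 𝒩.sets) (hB : B ∈ 𝒩.sets)
    (hJ : J ∈ 𝒩.sets) (hAJ : A ≠ J) (hBJ : B ≠ J) : A ∩ J = B ∩ J ∨ Disjoint (A ∩ J) B := by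
  by_cases hd : Disjoint (A ∩ J) B
  · exact Or.inr hd
  · obtain ⟨x, hx, hxB⟩ := Finset.not_disjoint_iff.1 hd
    rw [Finset.mem_inter] at hx
    have h1 := h {A, B, J} (by simp [Finset.insert_subset_iff, hA, hB, hJ])
      ⟨x, by simp [commonPart, hx.1, hx.2, hxB]⟩
    exact Or.inl ((h1 A (by simp) J (by simp) hAJ).trans (h1 B (by simp) J (by simp) hBJ).symm)

end NeighborhoodStructure

noncomputable section

namespace QuasiLocal

variable {ι : Type*} [Fintype ι] [DecidableEq ι]
  {κ : ι → Type*} [∀ i, Fintype (κ i)] [∀ i, DecidableEq (κ i)]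

lemma foldl_induction {p : Op κ → Prop} {l : List (Op κ →ₗ[ℂ] Op κ)}
    (h : ∀ F ∈ l, ∀ X, p X → p (F X)) {X : Op κ} (hX : p X) :
    p (l.foldl (fun Y F => F Y) X) := by
  induction l generalizing X with
  | nil => exact hX
  | cons F l ih => exact ih (fun G hG => h G (by simp [hG])) (h F (by simp) X hX)

lemma foldl_of_exists {p : Op κ → Prop} {l : List (Op κ →ₗ[ℂ] Op κ)}
    (h : ∀ F ∈ l, ∀ X, p X → p (F X)) (h' : ∃ F ∈ l, ∀ X, p (F X)) (X : Op κ) :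
    p (l.foldl (fun Y F => F Y) X) := by
  obtain ⟨F, hF, hFp⟩ := h'
  induction l generalizing X with
  | nil => simp at hF
  | cons G l ih =>
    rcases List.mem_cons.1 hF with rfl | hF'
    · exact foldl_induction (l := l) (fun G hG => h G (by simp [hG])) (hFp X)
    · exact ih (fun G hG => h G (by simp [hG])) (G X) hF'

/-- The completely positive map with the given Kraus operators. -/
def krausMap {r : ℕ} (M : Fin r → Op κ) : Op κ →ₗ[ℂ] Op κ :=
  ∑ k, LinearMap.mulLeft ℂ (M k) ∘ₗ LinearMap.mulRight ℂ (star (M k))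

lemma krausMap_apply {r : ℕ} (M : Fin r → Op κ) (X : Op κ) :
    krausMap M X = ∑ k, M k * X * star (M k) := by
  simp [krausMap, LinearMap.sum_apply, mul_assoc]

lemma trace_krausMap {r : ℕ} {M : Fin r → Op κ} (hM : ∑ k, star (M k) * M k = 1) (X : Op κ) :
    (krausMap M X).trace = X.trace := by
  rw [krausMap_apply, Matrix.trace_sum]
  calc ∑ k, (M k * X * star (M k)).trace = ∑ k, (star (M k) * M k * X).trace :=
        Finset.sum_congr rfl fun k _ => by rw [Matrix.trace_mul_comm, mul_assoc]
    _ = X.trace := by rw [← Matrix.trace_sum, ← Finset.sum_mul, hM, one_mul]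

lemma star_krausMap {r : ℕ} (M : Fin r → Op κ) {X : Op κ} (hX : star X = X) :
    star (krausMap M X) = krausMap M X := by
  simp only [krausMap_apply, star_sum, star_mul, star_star, hX, mul_assoc]

/-- Commuting local support projectors whose ranges have the target state as their common part
make the state robustly finite-time stabilizable. -/
lemma isRFTS_of_commute {𝒩 : NeighborhoodStructure ι} (h𝒩 : 𝒩.MatchingOverlap) {ψ : Space κ}
    (hψ : ‖ψ‖ = 1)
    (hcomm : ∀ S ∈ 𝒩.sets, ∀ S' ∈ 𝒩.sets, Commute (nbhdMat ψ S) (nbhdMat ψ S'))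
    (hmeet : meet 𝒩.sets (nbhdMat ψ) = pureState ψ) : IsRFTS 𝒩 (pureState ψ) := by
  have hpr := isStarProjection_pureState hψ
  have hproj : ∀ S ∈ 𝒩.sets, IsStarProjection (nbhdMat ψ S) :=
    fun S _ => isStarProjection_locSupp _ _
  have hkraus : ∀ J : 𝒩.sets, HasKraus fun M : Op κ => M ∈ loc κ J.1 ∧ nbhdMat ψ J.1 * M = M ∧
      ∀ k ∈ 𝒩.sets.erase J.1, nbhdMat ψ k * M * nbhdMat ψ k = M * nbhdMat ψ k := by
    rintro ⟨J, hJ⟩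
    refine hasKraus_nbhd hψ (fun i hi k hk => ?_) ?_ fun X hX hXJ => ?_
    · rw [Finset.mem_erase] at hi hk
      exact h𝒩.inter_eq_or_disjoint hi.2 hk.2 hJ hi.1 hk.1
    · exact (mem_symmetryAlgebra hψ).2 ⟨nbhdMat_mem_loc hψ J, fun k hk =>
        hcomm k (Finset.mem_of_mem_erase hk) J hJ⟩
    · rw [← hmeet]
      refine commute_meet hproj fun k hk => ?_
      by_cases h : k = J
      · rwa [h]
      · exact hX k (Finset.mem_erase.2 ⟨h, hk⟩)
  choose r M hM hsum using hkraus
  have hfix : ∀ (J : 𝒩.sets) (X : Op κ), nbhdMat ψ J.1 * krausMap (M J) X = krausMap (M J) X := by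
    intro J X
    rw [krausMap_apply, Finset.mul_sum]
    exact Finset.sum_congr rfl fun k _ => by rw [← mul_assoc, ← mul_assoc, (hM J k).2.1]
  have hpres : ∀ (J : 𝒩.sets), ∀ S ∈ 𝒩.sets, ∀ X : Op κ, nbhdMat ψ S * X = X →
      nbhdMat ψ S * krausMap (M J) X = krausMap (M J) X := by
    intro J S hS X hX
    by_cases h : S = J.1
    · rw [h, hfix]
    rw [krausMap_apply, Finset.mul_sum]
    refine Finset.sum_congr rfl fun k _ => ?_
    have h1 := (hM J k).2.2 S (Finset.mem_erase.2 ⟨h, hS⟩)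
    rw [← hX]
    simp only [← mul_assoc]
    rw [h1]
  -- Self-adjointness turns ρ X = X into X = ρ X ρ, a multiple of ρ that the trace fixes.
  have hfinal : ∀ X : Op κ, star X = X → X.trace = 1 → (∀ S ∈ 𝒩.sets, nbhdMat ψ S * X = X) →
      X = pureState ψ := by
    intro X hstar htr hX
    have h1 : pureState ψ * X = X := by
      rw [← hmeet]
      exact meet_mul hproj hX
    have h2 : X * pureState ψ = X := by
      have := congrArg star h1
      rwa [star_mul, hstar, isStarProjection_star hpr] at this
    have h3 := pureState_mul_mul_eq_trace hψ X
    rwa [h1, h2, htr, one_smul] at h3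
  refine ⟨Fintype.card 𝒩.sets, fun t => krausMap (M ((Fintype.equivFin 𝒩.sets).symm t)),
    fun t => ?_, fun t => ?_, fun p σ hσ => ?_⟩
  · set J := (Fintype.equivFin 𝒩.sets).symm t with hJ
    choose K hK using fun k => exists_eq_extend (hM J k).1
    refine ⟨J.1, J.2, r J, K, ?_, fun X => ?_⟩
    · simp only [← hK]
      exact hsum J
    · simp only [← hK]
      exact krausMap_apply _ _
  · refine hfinal _ (star_krausMap _ (isStarProjection_star hpr))
      ((trace_krausMap (hsum _) _).trans (trace_pureState hψ)) fun S hS =>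
      hpres _ S hS _ (locSupp_mul hpr)
  · have hmem : ∀ F ∈ List.ofFn (fun t => krausMap (M ((Fintype.equivFin 𝒩.sets).symm (p t)))),
        ∃ J, F = krausMap (M J) := by
      intro F hF
      obtain ⟨t, rfl⟩ := (List.mem_ofFn' _ _).1 hF
      exact ⟨_, rfl⟩
    refine hfinal _ ?_ ?_ fun S hS => ?_
    · refine foldl_induction (p := fun X => star X = X) (fun F hF X hX => ?_) hσ.1.isHermitian
      obtain ⟨J, rfl⟩ := hmem F hF
      exact star_krausMap _ hX
    · refine foldl_induction (p := fun X => X.trace = 1) (fun F hF X hX => ?_) hσ.2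
      obtain ⟨J, rfl⟩ := hmem F hF
      exact (trace_krausMap (hsum J) X).trans hX
    · refine foldl_of_exists (p := fun X => nbhdMat ψ S * X = X) (fun F hF X hX => ?_) ?_ σ
      · obtain ⟨J, rfl⟩ := hmem F hF
        exact hpres J S hS X hX
      · refine ⟨krausMap (M ⟨S, hS⟩), (List.mem_ofFn' _ _).2
          ⟨p.symm (Fintype.equivFin 𝒩.sets ⟨S, hS⟩), ?_⟩, hfix ⟨S, hS⟩⟩
        beta_reduce
        rw [Equiv.apply_symm_apply, Equiv.symm_apply_apply]

/-! ### Ground states of the canonical Hamiltonian. -/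

lemma opEquiv_mul_apply (A B : Op κ) (φ : Space κ) :
    opEquiv κ (A * B) φ = opEquiv κ A (opEquiv κ B φ) := by
  rw [map_mul, mul_apply_eq_comp]

lemma opEquiv_pureState_apply (ψ φ : Space κ) :
    opEquiv κ (pureState ψ) φ = (star ψ.ofLp ⬝ᵥ φ.ofLp) • ψ := by
  ext x
  change (pureState ψ *ᵥ φ.ofLp) x = _
  rw [pureState, Matrix.vecMulVec_mulVec]
  simp [mul_comm]

lemma opEquiv_pureState_self {ψ : Space κ} (hψ : ‖ψ‖ = 1) : opEquiv κ (pureState ψ) ψ = ψ := by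
  rw [opEquiv_pureState_apply, dotProduct_star_self hψ, one_smul]

lemma mul_pureState_eq_iff {A : Op κ} {φ : Space κ} (hφ : ‖φ‖ = 1) :
    A * pureState φ = pureState φ ↔ opEquiv κ A φ = φ := by
  constructor
  · intro h
    rw [← opEquiv_pureState_self hφ, ← opEquiv_mul_apply, h]
  · intro h
    have h' : A *ᵥ φ.ofLp = φ.ofLp := congrArg WithLp.ofLp h
    rw [pureState, Matrix.mul_vecMulVec, h']

lemma commute_nbhdProj_iff {ψ : Space κ} {S S' : Finset ι} :
    Commute (nbhdProj ψ S) (nbhdProj ψ S') ↔ Commute (nbhdMat ψ S) (nbhdMat ψ S') := by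
  rw [nbhdProj_eq, nbhdProj_eq, Commute, SemiconjBy, Commute, SemiconjBy, ← map_mul, ← map_mul]
  exact (EquivLike.injective (opEquiv κ)).eq_iff

lemma inner_canonicalHamiltonian (𝒩 : NeighborhoodStructure ι) (ψ φ : Space κ) :
    (inner ℂ φ (canonicalHamiltonian 𝒩 ψ φ)).re =
      ∑ S ∈ 𝒩.sets, ‖φ - nbhdProj ψ S φ‖ ^ 2 := by
  rw [canonicalHamiltonian, _root_.sum_apply, inner_sum, Complex.re_sum]
  refine Finset.sum_congr rfl fun S _ => ?_
  have h0 : IsStarProjection (nbhdProj ψ S) := isStarProjection_starProjection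
  have h := h0.one_sub
  have h1 : (1 - nbhdProj ψ S) φ = φ - nbhdProj ψ S φ := rfl
  have h2 : (1 - nbhdProj ψ S) φ = (1 - nbhdProj ψ S) ((1 - nbhdProj ψ S) φ) := by
    rw [← mul_apply_eq_comp, h.isIdempotentElem.eq]
  have h3 : ContinuousLinearMap.adjoint (1 - nbhdProj ψ S) = 1 - nbhdProj ψ S :=
    h.isSelfAdjoint.star_eq
  rw [h2]
  nth_rewrite 1 [← h3]
  rw [ContinuousLinearMap.adjoint_inner_right, inner_self_eq_norm_sq_to_K, h1]
  norm_cast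

/-- The unit vectors with zero energy are the ground states. -/
lemma isGroundState_iff {𝒩 : NeighborhoodStructure ι} {ψ φ : Space κ} (hψ : ‖ψ‖ = 1)
    (hφ : ‖φ‖ = 1) :
    IsGroundState (canonicalHamiltonian 𝒩 ψ) φ ↔ ∀ S ∈ 𝒩.sets, opEquiv κ (nbhdMat ψ S) φ = φ := by
  have hψS : ∀ S, opEquiv κ (nbhdMat ψ S) ψ = ψ := fun S =>
    (mul_pureState_eq_iff hψ).1 (locSupp_mul (isStarProjection_pureState hψ))
  constructor
  · rintro ⟨-, h⟩ S hS
    have h1 := h ψ hψ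
    rw [inner_canonicalHamiltonian, inner_canonicalHamiltonian] at h1
    have h2 : ∑ S ∈ 𝒩.sets, ‖ψ - nbhdProj ψ S ψ‖ ^ 2 = 0 :=
      Finset.sum_eq_zero fun S _ => by rw [nbhdProj_eq, hψS, sub_self, norm_zero]; norm_num
    rw [h2] at h1
    have h3 := (Finset.sum_eq_zero_iff_of_nonneg fun S _ => by positivity).1
      (le_antisymm h1 (Finset.sum_nonneg fun S _ => by positivity)) S hS
    rw [sq_eq_zero_iff, norm_eq_zero, sub_eq_zero, nbhdProj_eq] at h3
    exact h3.symm
  · intro h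
    refine ⟨hφ, fun χ _ => ?_⟩
    rw [inner_canonicalHamiltonian, inner_canonicalHamiltonian, Finset.sum_eq_zero fun S hS => by
      rw [nbhdProj_eq, h S hS, sub_self, norm_zero]; norm_num]
    exact Finset.sum_nonneg fun S _ => by positivity

/-- Since ψ has zero energy, the ground states are the unit vectors of the common range of the
projectors; uniqueness says that this range is the line of ψ. -/
lemma isUniqueGroundState_iff (𝒩 : NeighborhoodStructure ι) {ψ : Space κ} (hψ : ‖ψ‖ = 1) :
    IsUniqueGroundState (canonicalHamiltonian 𝒩 ψ) ψ ↔
      meet 𝒩.sets (nbhdMat ψ) = pureState ψ := by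
  have hpr := isStarProjection_pureState hψ
  have hproj : ∀ S ∈ 𝒩.sets, IsStarProjection (nbhdMat ψ S) :=
    fun S _ => isStarProjection_locSupp _ _
  constructor
  · rintro ⟨-, h⟩
    set R := meet 𝒩.sets (nbhdMat ψ) with hR
    have hRρ : R * pureState ψ = pureState ψ := meet_mul hproj fun S _ => locSupp_mul hpr
    have h1 : pureState ψ * R = R := by
      apply EquivLike.injective (opEquiv κ)
      ext1 χ
      rw [opEquiv_mul_apply]
      set φ := opEquiv κ R χ with hφ
      have hφS : ∀ S ∈ 𝒩.sets, opEquiv κ (nbhdMat ψ S) φ = φ := fun S hS => by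
        rw [hφ, ← opEquiv_mul_apply, mul_meet hproj hS]
      by_cases h0 : φ = 0
      · rw [h0, map_zero]
      have hn : ‖φ‖ ≠ 0 := norm_ne_zero_iff.2 h0
      have hunit : ‖((‖φ‖⁻¹ : ℝ) : ℂ) • φ‖ = 1 := by
        rw [norm_smul, Complex.norm_real, norm_inv, norm_norm, inv_mul_cancel₀ hn]
      obtain ⟨c, hc⟩ := h _ ((isGroundState_iff hψ hunit).2 fun S hS => by rw [map_smul, hφS S hS])
      have hφc : φ = (((‖φ‖⁻¹ : ℝ) : ℂ)⁻¹ * c) • ψ := by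
        rw [mul_smul, ← hc, inv_smul_smul₀]
        exact_mod_cast inv_ne_zero hn
      rw [hφc, map_smul, opEquiv_pureState_self hψ]
    have h2 := congrArg star h1
    rw [star_mul, isStarProjection_star hpr, isStarProjection_star (isStarProjection_meet _ _),
      hRρ] at h2
    exact h2.symm
  · intro h
    refine ⟨(isGroundState_iff hψ hψ).2 fun S _ =>
      (mul_pureState_eq_iff hψ).1 (locSupp_mul hpr), fun φ hφ => ?_⟩
    have hφS := (isGroundState_iff hψ hφ.1).1 hφ
    have h1 : meet 𝒩.sets (nbhdMat ψ) * pureState φ = pureState φ :=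
      meet_mul hproj fun S hS => (mul_pureState_eq_iff hφ.1).2 (hφS S hS)
    rw [h, mul_pureState_eq_iff hφ.1, opEquiv_pureState_apply] at h1
    exact ⟨_, h1.symm⟩

end QuasiLocal

end

theorem theorem3 {ι : Type*} [Fintype ι] [DecidableEq ι]
    {κ : ι → Type*} [∀ i, Fintype (κ i)] [∀ i, DecidableEq (κ i)]
    (𝒩 : NeighborhoodStructure ι) (h𝒩 : 𝒩.TreeLike)
    (ψ : QuasiLocal.Space κ) (hψ : ‖ψ‖ = 1) :
    QuasiLocal.IsRFTS 𝒩 (QuasiLocal.pureState ψ) ↔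
      (∀ S ∈ 𝒩.sets, ∀ S' ∈ 𝒩.sets,
        Commute (QuasiLocal.nbhdProj ψ S) (QuasiLocal.nbhdProj ψ S')) ∧
      QuasiLocal.IsUniqueGroundState (QuasiLocal.canonicalHamiltonian 𝒩 ψ) ψ := by
  simp only [QuasiLocal.commute_nbhdProj_iff]
  rw [QuasiLocal.isUniqueGroundState_iff 𝒩 hψ]
  constructor
  · intro h
    refine ⟨fun S hS S' hS' => QuasiLocal.commute_nbhdMat_of_isRFTS h𝒩.2 hψ h hS hS', ?_⟩
    -- Both families are taken to be all the neighborhoods, so the product is the square of one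
    -- projection.
    rw [← QuasiLocal.meet_mul_meet_of_isRFTS hψ h Finset.subset_union_left,
      QuasiLocal.isStarProjection_mul_self (QuasiLocal.isStarProjection_meet _ _)]
  · rintro ⟨hcomm, hmeet⟩
    exact QuasiLocal.isRFTS_of_commute h𝒩.1 hψ hcomm hmeet
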